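/- Let $G$ be a finite simple graph on $n\ge 1$ vertices. $G$ is representable in $\mathbb{R}^m$ if there are distinct positive constants $\alpha,\beta$ and a map $p:V(G)\to\mathbb{R}^m$ such that, for all distinct vertices $u,v$, $\|p(u)-p(v)\|=\alpha$ if $u\sim v$ and $\|p(u)-p(v)\|=\beta$ otherwise. The Euclidean representation number $\mathrm{Rep}(G)$ is the smallest $m$ such that $G$ is representable in $\mathbb{R}^m$; such an $m$ exists. (1) If $G$ or its complement $\overline G$ is the complete graph, then $\mathrm{Rep}(G)=n-1$. (2) If neither $G$ nor $\overline G$ is complete, and $G$ or $\overline G$ is a disjoint union of at least $2$ complete graphs, exactly $r$ of which have the largest size, then $\mathrm{Rep}(G)=n-\max\{r,2\}$. (3) In all other cases, let $\tau_1<\tau_2<\dots<\tau_s$ be the distinct eigenvalues of the adjacency matrix $A$ of $G$, let $m_i$ be the multiplicity of $\tau_i$, and let $\beta_i=\frac{1}{\sqrt n}\|P_i\mathbf 1\|$ be its main angle, where $P_i$ is the orthogonal projection onto the $\tau_i$-eigenspace and $\mathbf 1$ is the all-ones vector. Put \[ m_1'=\begin{cases} m_1+1, & \text{if } \beta_1=0;\\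 m_1, & \text{otherwise,}\end{cases} \] \[ m_2'=\begin{cases} m_2+2, & \text{if } \tau_2<-1,\ m_1=1,\ \beta_2=0 \text{ and } \frac{\beta_1^2}{\tau_2-\tau_1}=\sum_{i\ge 3}\frac{\beta_i^2}{\tau_i-\tau_2};\\ m_2+1, & \text{if } \tau_2<-1,\ m_1=1,\ \beta_2=0 \text{ and } \frac{\beta_1^2}{\tau_2-\tau_1}>\sum_{i\ge 3}\frac{\beta_i^2}{\tau_i-\tau_2};\\ 0, & \text{otherwise,}\end{cases} \] and let $\overline{m_1}'$, $\overline{m_2}'$ be the same quantities for $\overline G$. Then \[ \mathrm{Rep}(G)=n-\max\{m_1',m_2',\overline{m_1}',\overline{m_2}',2\}. \] -/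

import Mathlib

namespace EuclideanRep

/-- `G` is representable in `ℝ^m`: its vertices can be placed in Euclidean `m`-space so that
adjacent vertices are at distance `α` and distinct non-adjacent vertices at distance `β`, where
`α` and `β` are distinct positive constants. (Positivity makes the placement injective.) -/
def Representable {V : Type*} (G : SimpleGraph V) (m : ℕ) : Prop :=
  ∃ (p : V → EuclideanSpace ℝ (Fin m)) (α β : ℝ), 0 < α ∧ 0 < β ∧ α ≠ β ∧
    ∀ u v : V, u ≠ v →
      (G.Adj u v → ‖p u - p v‖ = α) ∧ (¬ G.Adj u v → ‖p u - p v‖ = β)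

/-- The Euclidean representation number: the smallest `m` such that `G` is representable
in `ℝ^m`. -/
noncomputable def repNumber {V : Type*} (G : SimpleGraph V) : ℕ :=
  sInf {m : ℕ | Representable G m}

/-- `G` is a disjoint union of at least two complete graphs: every connected component is a
clique, and there are at least two components. -/
def IsDisjointUnionOfCliques {V : Type*} (G : SimpleGraph V) : Prop :=
  (∀ c : G.ConnectedComponent, G.IsClique c.supp) ∧ 2 ≤ Nat.card G.ConnectedComponent

/-- The number of connected components having the largest number of vertices. -/
noncomputable def numLargestComponents {V : Type*} (G : SimpleGraph V) : ℕ :=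
  {c : G.ConnectedComponent |
    ∀ d : G.ConnectedComponent, d.supp.ncard ≤ c.supp.ncard}.ncard

section Spectrum

variable {V : Type*} [Fintype V] [DecidableEq V] (G : SimpleGraph V) [DecidableRel G.Adj]

/-- The adjacency matrix acting on Euclidean space. -/
noncomputable def adjOp : Module.End ℝ (EuclideanSpace ℝ V) :=
  Matrix.toEuclideanLin (G.adjMatrix ℝ)

/-- The finite set of distinct eigenvalues of the adjacency matrix. -/
noncomputable def eigenvalueSet : Finset ℝ :=
  (Module.End.finite_hasEigenvalue (adjOp G)).toFinset

/-- The number `s` of distinct eigenvalues. -/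
noncomputable def numEigenvalues : ℕ := (eigenvalueSet G).card

/-- `τ_i`: the `i`-th smallest distinct eigenvalue, for `1 ≤ i ≤ s`
(the value is `0` for an index `i` outside this range). -/
noncomputable def eigenvalue (i : ℕ) : ℝ :=
  if h : 1 ≤ i ∧ i ≤ numEigenvalues G then
    (eigenvalueSet G).orderEmbOfFin (k := numEigenvalues G) rfl ⟨i - 1, by omega⟩
  else 0

/-- `E_i`: the eigenspace of `τ_i`. -/
noncomputable def eigenSubspace (i : ℕ) : Submodule ℝ (EuclideanSpace ℝ V) :=
  Module.End.eigenspace (adjOp G) (eigenvalue G i)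

/-- `m_i`: the multiplicity of `τ_i`. The adjacency matrix is real symmetric, so this is the
dimension of the eigenspace. -/
noncomputable def mult (i : ℕ) : ℕ := Module.finrank ℝ (eigenSubspace G i)

/-- `β_i`: the main angle of `τ_i`, that is `n^(-1/2) ‖P_i 𝟏‖` with `P_i` the orthogonal
projection onto `E_i` and `𝟏` the all-ones vector. -/
noncomputable def mainAngle (i : ℕ) : ℝ :=
  1 / Real.sqrt (Fintype.card V) *
    ‖(eigenSubspace G i).starProjection (WithLp.toLp 2 (fun _ : V => (1 : ℝ)))‖

/-- `m_1'`. -/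
noncomputable def mOne' : ℕ :=
  if mainAngle G 1 = 0 then mult G 1 + 1 else mult G 1

/-- The left-hand side `β_1² / (τ_2 - τ_1)`. -/
noncomputable def lhsTwo : ℝ :=
  mainAngle G 1 ^ 2 / (eigenvalue G 2 - eigenvalue G 1)

/-- The right-hand side `∑_{i ≥ 3} β_i² / (τ_i - τ_2)`. -/
noncomputable def rhsTwo : ℝ :=
  ∑ i ∈ Finset.Icc 3 (numEigenvalues G),
    mainAngle G i ^ 2 / (eigenvalue G i - eigenvalue G 2)

/-- `m_2'`. -/
noncomputable def mTwo' : ℕ :=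
  if eigenvalue G 2 < -1 ∧ mult G 1 = 1 ∧ mainAngle G 2 = 0 ∧ lhsTwo G = rhsTwo G then
    mult G 2 + 2
  else if eigenvalue G 2 < -1 ∧ mult G 1 = 1 ∧ mainAngle G 2 = 0 ∧ rhsTwo G < lhsTwo G then
    mult G 2 + 1
  else 0

end Spectrum

end EuclideanRep

/-! For points p(u), the Gram form of x ↦ ∑ x_u p(u), restricted to vectors of coordinate sum zero,
depends only on squared distances. If α < β it is a positive multiple of the form of A - μ, with μ =
-β²/(β² - α²) < -1. Conversely, every μ < -1 for which A - μ is positive semidefinite on this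
hyperplane gives a representation in dimension n - 1 minus the nullity. The case β < α is the same
statement for the complement. Hence Rep(G) is n - 1 minus the largest nullity occurring for G or its
complement (`representable_iff`, `repNumber_add_of_isMaxNullity`). A nonzero radical occurs only
when μ is the least eigenvalue of the compression of A to the hyperplane (`Feasible.isMaxNullity`),
so it remains to find the multiplicity of that eigenvalue whenever it is below -1.

For a disjoint union of cliques, A + 1 is the sum of the squared clique sums, so G contributes
nullity 0. On the hyperplane the complement's form is minus that sum of squares, and Cauchy–Schwarz
inside each clique controls its minimum.

If some component is not a clique, an induced path pushes the least eigenvalue below -1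
(`Feasible.lt_neg_one`). That eigenvalue is τ_1 as soon as the first eigenspace meets the hyperplane
nontrivially, that is, if β_1 = 0 or m_1 > 1. Otherwise m_1 = 1, and vectors with no component in
that eigenspace have Rayleigh quotient at least τ_2. So the least eigenvalue is simple if it is
below τ_2. It equals τ_2 exactly when β_2 = 0 and the main angle inequality holds, by a weighted
Cauchy–Schwarz estimate; equality there adds one null vector outside the second eigenspace
(`isMaxNullity_of_not_isClique`). -/

open scoped InnerProductSpace

namespace EuclideanRep

/-! ### Euclidean embeddings and semidefinite forms -/

/-- An inner product space of dimension at most `m` embeds isometrically in Euclidean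
`m`-space. -/
theorem exists_linearIsometry_euclideanSpace {F : Type*} [NormedAddCommGroup F]
    [InnerProductSpace ℝ F] [FiniteDimensional ℝ F] {m : ℕ} (h : Module.finrank ℝ F ≤ m) :
    Nonempty (F →ₗᵢ[ℝ] EuclideanSpace ℝ (Fin m)) := by
  let b := stdOrthonormalBasis ℝ F
  let e := EuclideanSpace.basisFun (Fin m) ℝ
  let f : F →ₗ[ℝ] EuclideanSpace ℝ (Fin m) := b.toBasis.constr ℝ (fun i => e (Fin.castLE h i))
  refine ⟨f.isometryOfOrthonormal (v := b.toBasis) (by simp [b.orthonormal]) ?_⟩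
  have : f ∘ b.toBasis = e ∘ Fin.castLE h := by
    funext i
    simp [f, Module.Basis.constr_apply_fintype]
  rw [this]
  exact e.orthonormal.comp _ (Fin.castLE_injective h)

/-- A positive semidefinite symmetric operator is a Gram operator. -/
theorem exists_inner_eq_inner_of_symmetric {F : Type*} [NormedAddCommGroup F]
    [InnerProductSpace ℝ F] [FiniteDimensional ℝ F] {S : F →ₗ[ℝ] F} (hS : S.IsSymmetric)
    (hpos : ∀ x, 0 ≤ ⟪S x, x⟫_ℝ) :
    ∃ L : F →ₗ[ℝ] F, ∀ x y, ⟪L x, L y⟫_ℝ = ⟪S x, y⟫_ℝ := by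
  let b := hS.eigenvectorBasis rfl
  let l := hS.eigenvalues rfl
  have hSb : ∀ i, S (b i) = l i • b i := hS.apply_eigenvectorBasis rfl
  have hl : ∀ i, 0 ≤ l i := fun i => by
    have := hpos (b i)
    rwa [hSb, real_inner_smul_left, real_inner_self_eq_norm_sq, b.orthonormal.1 i, one_pow,
      mul_one] at this
  -- This is the positive square root of `S`, diagonal in its eigenbasis.
  refine ⟨b.toBasis.constr ℝ (fun i => √(l i) • b i), fun x y => ?_⟩
  have hL : ∀ x i, ⟪b.toBasis.constr ℝ (fun i => √(l i) • b i) x, b i⟫_ℝ = √(l i) * ⟪x, b i⟫_ℝ := by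
    intro x i
    rw [Module.Basis.constr_apply_fintype, sum_inner]
    rw [Finset.sum_eq_single i]
    · rw [real_inner_smul_left, real_inner_smul_left, real_inner_self_eq_norm_sq,
        b.orthonormal.1 i]
      simp [b.repr_apply_apply, real_inner_comm, mul_comm]
    · intro j _ hj
      simp [real_inner_smul_left, b.inner_eq_zero hj]
    · simp
  rw [← b.sum_inner_mul_inner, ← b.sum_inner_mul_inner (S x)]
  refine Finset.sum_congr rfl fun i _ => ?_
  rw [hL, real_inner_comm _ (b i), hL, hS, hSb, real_inner_smul_right, real_inner_comm (b i) y]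
  linear_combination (⟪x, b i⟫_ℝ * ⟪b i, y⟫_ℝ) * Real.mul_self_sqrt (hl i)

/-- Vectors on which a positive semidefinite form vanishes lie in its radical. -/
theorem inner_eq_zero_of_form_eq_zero {F : Type*} [NormedAddCommGroup F]
    [InnerProductSpace ℝ F] {S : F →ₗ[ℝ] F} (hS : S.IsSymmetric) {U : Submodule ℝ F}
    (hpos : ∀ x ∈ U, 0 ≤ ⟪S x, x⟫_ℝ) {x y : F} (hx : x ∈ U) (hy : y ∈ U)
    (h : ⟪S x, x⟫_ℝ = 0) : ⟪S x, y⟫_ℝ = 0 := by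
  -- The form at `x + t • y` is a nonnegative quadratic in `t` with no constant term, so its
  -- discriminant, the square of the linear coefficient, must vanish.
  have key : ∀ t : ℝ, 0 ≤ ⟪S y, y⟫_ℝ * (t * t) + 2 * ⟪S x, y⟫_ℝ * t + 0 := fun t => by
    have := hpos (x + t • y) (U.add_mem hx (U.smul_mem t hy))
    have e : ⟪S y, x⟫_ℝ = ⟪S x, y⟫_ℝ := by rw [hS, real_inner_comm]
    simp only [map_add, map_smul, inner_add_left, inner_add_right, real_inner_smul_left,
      real_inner_smul_right, h, e] at this
    linarith
  have := discrim_le_zero key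
  simp only [discrim] at this
  nlinarith [sq_nonneg ⟪S x, y⟫_ℝ]

theorem representable_compl {V : Type*} {G : SimpleGraph V} {m : ℕ} (h : Representable G m) :
    Representable Gᶜ m := by
  obtain ⟨p, α, β, hα, hβ, hne, hp⟩ := h
  refine ⟨p, β, α, hβ, hα, hne.symm, fun u v huv => ?_⟩
  simp only [SimpleGraph.compl_adj, not_and, not_not]
  exact ⟨fun h => (hp u v huv).2 h.2, fun h => (hp u v huv).1 (h huv)⟩

theorem representable_compl_iff {V : Type*} {G : SimpleGraph V} {m : ℕ} :
    Representable Gᶜ m ↔ Representable G m :=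
  ⟨fun h => by simpa using representable_compl h, representable_compl⟩

/-! ### Representations as semidefinite forms on the sum-zero hyperplane -/

section

variable {V : Type*} [Fintype V]

variable (V) in
/-- The hyperplane orthogonal to the all-ones vector. -/
noncomputable def sumZero : Submodule ℝ (EuclideanSpace ℝ V) :=
  (ℝ ∙ (WithLp.toLp 2 (fun _ : V => (1 : ℝ))))ᗮ

theorem mem_sumZero_iff_inner {x : EuclideanSpace ℝ V} :
    x ∈ sumZero V ↔ ⟪x, WithLp.toLp 2 (fun _ : V => (1 : ℝ))⟫_ℝ = 0 := by
  rw [sumZero, Submodule.mem_orthogonal_singleton_iff_inner_left]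

theorem inner_ones (x : EuclideanSpace ℝ V) :
    ⟪x, WithLp.toLp 2 (fun _ : V => (1 : ℝ))⟫_ℝ = ∑ v, x v := by
  simp [PiLp.inner_apply]

theorem mem_sumZero {x : EuclideanSpace ℝ V} : x ∈ sumZero V ↔ ∑ v, x v = 0 := by
  rw [mem_sumZero_iff_inner, inner_ones]

theorem finrank_sumZero [Nonempty V] : Module.finrank ℝ (sumZero V) + 1 = Fintype.card V := by
  have h := (ℝ ∙ (WithLp.toLp 2 (fun _ : V => (1 : ℝ)))).finrank_add_finrank_orthogonal
  rw [finrank_span_singleton, finrank_euclideanSpace] at h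
  · rw [← h, add_comm]; rfl
  · intro h0
    obtain ⟨v⟩ := ‹Nonempty V›
    have := congrFun (congrArg WithLp.ofLp h0) v
    simp at this

/-- A subspace not inside the hyperplane meets it in codimension one. -/
theorem finrank_inf_sumZero {W : Submodule ℝ (EuclideanSpace ℝ V)} (hW : ¬ W ≤ sumZero V) :
    Module.finrank ℝ (W ⊓ sumZero V : Submodule ℝ (EuclideanSpace ℝ V)) + 1 =
      Module.finrank ℝ W := by
  let f : W →ₗ[ℝ] ℝ :=
    (innerₛₗ ℝ (WithLp.toLp 2 (fun _ : V => (1 : ℝ)))).comp W.subtype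
  have hf : ∀ x : W, f x = 0 ↔ (x : EuclideanSpace ℝ V) ∈ sumZero V := fun x => by
    rw [mem_sumZero_iff_inner, real_inner_comm]; rfl
  have hne : f ≠ 0 := by
    rintro h
    exact hW fun x hx => (hf ⟨x, hx⟩).1 (by rw [h]; rfl)
  have hsurj : LinearMap.range f = ⊤ := LinearMap.range_eq_top.2 (LinearMap.surjective hne)
  have hk : (LinearMap.ker f).map W.subtype = W ⊓ sumZero V := by
    ext x
    constructor
    · rintro ⟨y, hy, rfl⟩
      exact ⟨y.2, (hf y).1 hy⟩
    · rintro ⟨h1, h2⟩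
      exact ⟨⟨x, h1⟩, (hf ⟨x, h1⟩).2 h2, rfl⟩
  have := f.finrank_range_add_finrank_ker
  rw [hsurj, finrank_top, Module.finrank_self] at this
  rw [← hk, Submodule.finrank_map_subtype_eq, ← this, add_comm]

variable [DecidableEq V] (G : SimpleGraph V) [DecidableRel G.Adj]

theorem adjOp_isSymmetric : (adjOp G).IsSymmetric :=
  Matrix.isSymmetric_toEuclideanLin_iff.2 (G.isHermitian_adjMatrix ℝ)

theorem inner_adjOp (x y : EuclideanSpace ℝ V) :
    ⟪adjOp G x, y⟫_ℝ = ∑ u, ∑ v, x u * y v * (if G.Adj u v then 1 else 0) := by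
  rw [adjOp_isSymmetric G]
  simp only [PiLp.inner_apply, adjOp, Matrix.toLpLin_apply, Matrix.mulVec, dotProduct,
    SimpleGraph.adjMatrix_apply, RCLike.inner_apply, conj_trivial, Finset.sum_mul]
  refine Finset.sum_congr rfl fun u _ => Finset.sum_congr rfl fun v _ => ?_
  ring

theorem inner_adjOp_single (u v : V) :
    ⟪adjOp G (EuclideanSpace.single u 1), EuclideanSpace.single v 1⟫_ℝ =
      if G.Adj u v then 1 else 0 := by
  rw [inner_adjOp, Finset.sum_eq_single u, Finset.sum_eq_single v]
  · simp
  · intro w _ hw; simp [hw]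
  · simp
  · intro w _ hw; simp [hw]
  · simp

theorem inner_eq_sum_ite (x y : EuclideanSpace ℝ V) :
    ⟪x, y⟫_ℝ = ∑ u, ∑ v, x u * y v * (if u = v then 1 else 0) := by
  simp [PiLp.inner_apply, mul_comm]

/-- The form of `A - μ` restricted to the hyperplane is positive semidefinite. -/
def Feasible (μ : ℝ) : Prop :=
  ∀ x ∈ sumZero V, μ * ‖x‖ ^ 2 ≤ ⟪adjOp G x, x⟫_ℝ

/-- The radical of the form of `A - μ` on the hyperplane. -/
noncomputable def radical (μ : ℝ) : Submodule ℝ (EuclideanSpace ℝ V) where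
  carrier := {x | x ∈ sumZero V ∧ ∀ y ∈ sumZero V, ⟪adjOp G x, y⟫_ℝ = μ * ⟪x, y⟫_ℝ}
  zero_mem' := ⟨zero_mem _, by simp⟩
  add_mem' := fun {a b} ha hb => ⟨add_mem ha.1 hb.1, fun y hy => by
    rw [map_add, inner_add_left, inner_add_left, ha.2 y hy, hb.2 y hy, mul_add]⟩
  smul_mem' := fun t a ha => ⟨Submodule.smul_mem _ _ ha.1, fun y hy => by
    rw [map_smul, real_inner_smul_left, real_inner_smul_left, ha.2 y hy]; ring⟩

variable {G}

theorem mem_radical {μ : ℝ} {x : EuclideanSpace ℝ V} : x ∈ radical G μ ↔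
    x ∈ sumZero V ∧ ∀ y ∈ sumZero V, ⟪adjOp G x, y⟫_ℝ = μ * ⟪x, y⟫_ℝ := Iff.rfl

theorem isSymmetric_adjOp_sub (G : SimpleGraph V) [DecidableRel G.Adj] (μ : ℝ) :
    (adjOp G - μ • LinearMap.id).IsSymmetric := by
  intro x y
  have := adjOp_isSymmetric G x y
  simp only [LinearMap.sub_apply, LinearMap.smul_apply, LinearMap.id_apply, inner_sub_left,
    inner_sub_right, real_inner_smul_left, real_inner_smul_right, this]

/-- For a semidefinite form, isotropic vectors are already in the radical. Nullity can then be read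
off from Rayleigh quotients alone. -/
theorem Feasible.mem_radical_iff {μ : ℝ} (h : Feasible G μ) {x : EuclideanSpace ℝ V} :
    x ∈ radical G μ ↔ x ∈ sumZero V ∧ ⟪adjOp G x, x⟫_ℝ = μ * ‖x‖ ^ 2 := by
  refine ⟨fun hx => ⟨hx.1, by rw [hx.2 x hx.1, real_inner_self_eq_norm_sq]⟩,
    fun hx => ⟨hx.1, fun y hy => ?_⟩⟩
  have key := inner_eq_zero_of_form_eq_zero (isSymmetric_adjOp_sub G μ) (U := sumZero V)
    (fun z hz => by
      have := h z hz
      simp only [LinearMap.sub_apply, LinearMap.smul_apply, LinearMap.id_apply, inner_sub_left,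
        real_inner_smul_left, real_inner_self_eq_norm_sq]
      linarith) hx.1 hy
    (by
      simp only [LinearMap.sub_apply, LinearMap.smul_apply, LinearMap.id_apply, inner_sub_left,
        real_inner_smul_left, real_inner_self_eq_norm_sq, hx.2, sub_self])
  simp only [LinearMap.sub_apply, LinearMap.smul_apply, LinearMap.id_apply, inner_sub_left,
    real_inner_smul_left] at key
  linarith

/-- The map on the hyperplane whose kernel is the radical has the complementary rank. -/
theorem finrank_range_add_finrank_radical {F : Type*} [NormedAddCommGroup F]
    [InnerProductSpace ℝ F] [FiniteDimensional ℝ F] {μ t : ℝ} (ht : t ≠ 0)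
    (L : EuclideanSpace ℝ V →ₗ[ℝ] F)
    (hL : ∀ x ∈ sumZero V, ∀ y ∈ sumZero V,
      ⟪L x, L y⟫_ℝ = t * (⟪adjOp G x, y⟫_ℝ - μ * ⟪x, y⟫_ℝ)) [Nonempty V] :
    Module.finrank ℝ (LinearMap.range (L.comp (sumZero V).subtype)) +
      Module.finrank ℝ (radical G μ) + 1 = Fintype.card V := by
  have hk : (LinearMap.ker (L.comp (sumZero V).subtype)).map (sumZero V).subtype =
      radical G μ := by
    ext x
    constructor
    · rintro ⟨y, hy, rfl⟩
      refine ⟨y.2, fun z hz => ?_⟩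
      have h1 := hL y y.2 z hz
      have h2 : L y = 0 := hy
      rw [h2, inner_zero_left] at h1
      have := (mul_eq_zero.1 h1.symm).resolve_left ht
      exact sub_eq_zero.1 this
    · intro hx
      refine ⟨⟨x, hx.1⟩, ?_, rfl⟩
      have h1 := hL x hx.1 x hx.1
      rw [hx.2 x hx.1, sub_self, mul_zero, inner_self_eq_zero] at h1
      exact h1
  have := (L.comp (sumZero V).subtype).finrank_range_add_finrank_ker
  rw [← hk, Submodule.finrank_map_subtype_eq, this, finrank_sumZero]

theorem Representable.of_feasible [Nonempty V] {m : ℕ} {μ : ℝ} (hμ : μ < -1)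
    (h : Feasible G μ) (hm : Fintype.card V ≤ m + Module.finrank ℝ (radical G μ) + 1) :
    Representable G m := by
  -- Compressing by the projection makes the form semidefinite on the whole space, so it has a Gram
  -- operator there.
  set P : EuclideanSpace ℝ V →ₗ[ℝ] EuclideanSpace ℝ V :=
    (sumZero V).starProjection.toLinearMap with hP
  have hPs : P.IsSymmetric := by
    intro x y
    exact Submodule.inner_starProjection_left_eq_right _ x y
  have hPU : ∀ x, P x ∈ sumZero V := fun x => Submodule.starProjection_apply_mem _ x
  have hPid : ∀ x ∈ sumZero V, P x = x := fun x hx =>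
    Submodule.starProjection_eq_self_iff.2 hx
  obtain ⟨L, hL⟩ := exists_inner_eq_inner_of_symmetric
    (S := P ∘ₗ (adjOp G - μ • LinearMap.id) ∘ₗ P)
    (fun x y => by
      simp only [LinearMap.comp_apply]
      rw [hPs, isSymmetric_adjOp_sub, hPs])
    (fun x => by
      simp only [LinearMap.comp_apply]
      rw [hPs]
      have := h (P x) (hPU x)
      simp only [LinearMap.sub_apply, LinearMap.smul_apply, LinearMap.id_apply, inner_sub_left,
        real_inner_smul_left, real_inner_self_eq_norm_sq]
      linarith)
  have hLU : ∀ x ∈ sumZero V, ∀ y ∈ sumZero V,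
      ⟪L x, L y⟫_ℝ = 1 * (⟪adjOp G x, y⟫_ℝ - μ * ⟪x, y⟫_ℝ) := fun x hx y hy => by
    rw [hL]
    simp only [LinearMap.comp_apply]
    rw [hPs, hPid x hx, hPid y hy]
    simp only [LinearMap.sub_apply, LinearMap.smul_apply, LinearMap.id_apply, inner_sub_left,
        real_inner_smul_left, one_mul]
  have hr := finrank_range_add_finrank_radical one_ne_zero L hLU
  obtain ⟨J⟩ := exists_linearIsometry_euclideanSpace (m := m)
    (F := LinearMap.range (L.comp (sumZero V).subtype)) (by omega)
  let e : V → EuclideanSpace ℝ V := fun u => EuclideanSpace.single u 1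
  -- Basis vectors are not in the hyperplane but their differences are, so projecting them first
  -- does not alter the distances.
  let q : V → LinearMap.range (L.comp (sumZero V).subtype) := fun u =>
    ⟨L (P (e u)), ⟨⟨P (e u), hPU _⟩, rfl⟩⟩
  have hq : ∀ u v, u ≠ v → ‖J (q u) - J (q v)‖ ^ 2 = -2 * μ - 2 * (if G.Adj u v then 1 else 0) := by
    intro u v huv
    have hmem : e u - e v ∈ sumZero V := by
      rw [mem_sumZero]; simp [e]
    rw [← map_sub, J.norm_map, ← Submodule.norm_coe]
    have : ((q u - q v : LinearMap.range (L.comp (sumZero V).subtype)) : EuclideanSpace ℝ V)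
        = L (e u - e v) := by
      simp only [q, AddSubgroupClass.coe_sub, ← map_sub]
      rw [hPid _ hmem]
    rw [this, ← real_inner_self_eq_norm_sq, hLU _ hmem _ hmem]
    have hvu := huv.symm
    simp only [e, map_sub, inner_sub_left, inner_sub_right, inner_adjOp_single,
      EuclideanSpace.inner_single_left, PiLp.single_apply, G.adj_comm v u,
      SimpleGraph.irrefl, if_true, if_false, huv, hvu, map_one]
    ring
  -- The condition `μ < -1` is precisely positivity of the smaller squared distance.
  refine ⟨fun u => J (q u), √(-2 * μ - 2), √(-2 * μ), Real.sqrt_pos.2 (by linarith),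
    Real.sqrt_pos.2 (by linarith), ?_, fun u v huv => ⟨fun ha => ?_, fun ha => ?_⟩⟩
  · intro h
    rw [Real.sqrt_inj (by linarith) (by linarith)] at h
    linarith
  · rw [← Real.sqrt_sq (norm_nonneg _), hq u v huv]; simp [ha]
  · rw [← Real.sqrt_sq (norm_nonneg _), hq u v huv]; simp [ha]

theorem Representable.feasible [Nonempty V] {m : ℕ} {p : V → EuclideanSpace ℝ (Fin m)} {α β : ℝ}
    (hα : 0 < α) (hαβ : α < β)
    (hp : ∀ u v : V, u ≠ v → (G.Adj u v → ‖p u - p v‖ = α) ∧ (¬ G.Adj u v → ‖p u - p v‖ = β)) :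
    ∃ μ < -1, Feasible G μ ∧ Fintype.card V ≤ m + Module.finrank ℝ (radical G μ) + 1 := by
  have hd : 0 < β ^ 2 - α ^ 2 := by nlinarith
  -- The squared distance matrix is β²(J - I) - 2tA, with J the all-ones matrix. On the hyperplane J
  -- drops out, and the Gram form is -1/2 times the rest, namely tA + (β²/2)I. This is t(A - μ) for
  -- the `μ` chosen next.
  set t := (β ^ 2 - α ^ 2) / 2 with ht
  set μ := - (β ^ 2 / (β ^ 2 - α ^ 2)) with hμ
  have htμ : t * μ = - β ^ 2 / 2 := by
    rw [ht, hμ]; field_simp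
  let L : EuclideanSpace ℝ V →ₗ[ℝ] EuclideanSpace ℝ (Fin m) :=
    (Fintype.linearCombination ℝ p).comp (WithLp.linearEquiv 2 ℝ (V → ℝ)).toLinearMap
  have hLx : ∀ x, L x = ∑ u, x u • p u := fun x => by
    simp [L, Fintype.linearCombination_apply]
  have hdist : ∀ u v, ‖p u - p v‖ * ‖p u - p v‖ =
      β ^ 2 - β ^ 2 * (if u = v then 1 else 0) - 2 * t * (if G.Adj u v then 1 else 0) := by
    intro u v
    by_cases huv : u = v
    · simp [huv]
    · by_cases ha : G.Adj u v
      · rw [(hp u v huv).1 ha]; simp [huv, ha, ht]; ring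
      · rw [(hp u v huv).2 ha]; simp [huv, ha]; ring
  have hL : ∀ x ∈ sumZero V, ∀ y ∈ sumZero V,
      ⟪L x, L y⟫_ℝ = t * (⟪adjOp G x, y⟫_ℝ - μ * ⟪x, y⟫_ℝ) := by
    intro x hx y hy
    rw [hLx, hLx, inner_sum_smul_sum_smul_of_sum_eq_zero _ (mem_sumZero.1 hx) _
      (mem_sumZero.1 hy), inner_adjOp, inner_eq_sum_ite]
    have h0 : ∑ u, ∑ v, x u * y v = 0 := by
      rw [← Finset.sum_mul_sum, mem_sumZero.1 hx, zero_mul]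
    have : ∀ u v, x u * y v * (‖p u - p v‖ * ‖p u - p v‖) = β ^ 2 * (x u * y v) -
        β ^ 2 * (x u * y v * (if u = v then 1 else 0)) -
        2 * t * (x u * y v * (if G.Adj u v then 1 else 0)) := fun u v => by
      rw [hdist]; ring
    simp only [this, Finset.sum_sub_distrib]
    simp only [← Finset.mul_sum] at h0 ⊢
    rw [h0]
    linear_combination (∑ u, ∑ v, x u * y v * (if u = v then 1 else 0)) * htμ
  refine ⟨μ, ?_, fun x hx => ?_, ?_⟩
  · rw [hμ, neg_lt_neg_iff, lt_div_iff₀ hd]; nlinarith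
  · have := hL x hx x hx
    rw [real_inner_self_eq_norm_sq, real_inner_self_eq_norm_sq] at this
    have ht0 : 0 < t := by positivity
    have h2 : 0 ≤ t * (⟪adjOp G x, x⟫_ℝ - μ * ‖x‖ ^ 2) := this ▸ sq_nonneg _
    have := nonneg_of_mul_nonneg_right h2 ht0
    linarith
  · have hr := finrank_range_add_finrank_radical (G := G) (by positivity : t ≠ 0) L hL
    have := Submodule.finrank_le (LinearMap.range (L.comp (sumZero V).subtype))
    rw [finrank_euclideanSpace_fin] at this
    omega

theorem representable_iff [Nonempty V] {m : ℕ} : Representable G m ↔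
    (∃ μ < -1, Feasible G μ ∧ Fintype.card V ≤ m + Module.finrank ℝ (radical G μ) + 1) ∨
    (∃ μ < -1, Feasible Gᶜ μ ∧ Fintype.card V ≤ m + Module.finrank ℝ (radical Gᶜ μ) + 1) := by
  constructor
  · rintro ⟨p, α, β, hα, hβ, hne, hp⟩
    rcases lt_or_gt_of_ne hne with h | h
    · exact Or.inl (Representable.feasible hα h hp)
    · refine Or.inr (Representable.feasible hβ h (p := p) fun u v huv => ?_)
      simp only [SimpleGraph.compl_adj, not_and, not_not]
      exact ⟨fun h => (hp u v huv).2 h.2, fun h => (hp u v huv).1 (h huv)⟩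
  · rintro (⟨μ, hμ, h, hm⟩ | ⟨μ, hμ, h, hm⟩)
    · exact Representable.of_feasible hμ h hm
    · exact representable_compl_iff.1 (Representable.of_feasible hμ h hm)

/-! ### The largest nullity -/

variable (G) in
/-- `K` is the largest nullity of a positive semidefinite form `A - μ`, `μ < -1`, on the
hyperplane. -/
def IsMaxNullity (K : ℕ) : Prop :=
  (∀ μ < -1, Feasible G μ → Module.finrank ℝ (radical G μ) ≤ K) ∧
    ∃ μ < -1, Feasible G μ ∧ Module.finrank ℝ (radical G μ) = K

theorem repNumber_add_of_isMaxNullity [Nonempty V] {K K' : ℕ} (h : IsMaxNullity G K)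
    (h' : IsMaxNullity Gᶜ K') : (∃ m, Representable G m) ∧
      repNumber G + (max K K' + 1) = Fintype.card V := by
  have hrep : ∀ m, Representable G m ↔ Fintype.card V ≤ m + (max K K' + 1) := by
    intro m
    rw [representable_iff]
    constructor
    · rintro (⟨μ, hμ, hf, hm⟩ | ⟨μ, hμ, hf, hm⟩)
      · have := h.1 μ hμ hf; omega
      · have := h'.1 μ hμ hf; omega
    · intro hm
      rcases le_total K' K with hK | hK
      · obtain ⟨μ, hμ, hf, e⟩ := h.2
        exact Or.inl ⟨μ, hμ, hf, by omega⟩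
      · obtain ⟨μ, hμ, hf, e⟩ := h'.2
        exact Or.inr ⟨μ, hμ, hf, by omega⟩
  have hle : ∀ (H : SimpleGraph V) [DecidableRel H.Adj] (μ : ℝ),
      Module.finrank ℝ (radical H μ) + 1 ≤ Fintype.card V := by
    intro H _ μ
    rw [← finrank_sumZero]
    exact Nat.succ_le_succ (Submodule.finrank_mono fun x hx => hx.1)
  have hK : max K K' + 1 ≤ Fintype.card V := by
    obtain ⟨μ, hμ, hf, e⟩ := h.2
    obtain ⟨μ', hμ', hf', e'⟩ := h'.2
    have := hle G μ
    have := hle Gᶜ μ'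
    omega
  refine ⟨⟨Fintype.card V, (hrep _).2 (by omega)⟩, ?_⟩
  have : repNumber G = Fintype.card V - (max K K' + 1) := by
    apply IsLeast.csInf_eq
    refine ⟨(hrep _).2 (by omega), fun m hm => ?_⟩
    have := (hrep m).1 hm
    omega
  omega

/-- A feasible form with nonzero radical realizes the largest nullity. -/
theorem Feasible.isMaxNullity {μ : ℝ} (h : Feasible G μ) (hμ : μ < -1)
    (h0 : radical G μ ≠ ⊥) : IsMaxNullity G (Module.finrank ℝ (radical G μ)) := by
  refine ⟨fun ν _ hf => ?_, μ, hμ, h, rfl⟩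
  -- Below `μ` the form is positive definite on the hyperplane; above `μ` it is negative on a
  -- nonzero vector of the radical at `μ`.
  rcases lt_trichotomy ν μ with hlt | rfl | hlt
  · have : radical G ν = ⊥ := by
      rw [Submodule.eq_bot_iff]
      intro x hx
      have h1 := (hf.mem_radical_iff.1 hx).2
      have h2 := h x hx.1
      by_contra hne
      have : 0 < ‖x‖ ^ 2 := by positivity
      nlinarith
    rw [this, finrank_bot]
    exact Nat.zero_le _
  · exact le_rfl
  · obtain ⟨x, hx, hne⟩ := Submodule.exists_mem_ne_zero_of_ne_bot h0
    have h1 := (h.mem_radical_iff.1 hx).2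
    have h2 := hf x hx.1
    have : 0 < ‖x‖ ^ 2 := by positivity
    nlinarith

/-- The smallest eigenvalue of the compression of `A` to the hyperplane. -/
theorem exists_feasible_radical_ne_bot [Nontrivial V] (G : SimpleGraph V) [DecidableRel G.Adj] :
    ∃ μ, Feasible G μ ∧ radical G μ ≠ ⊥ := by
  have hcomp : IsCompact (Metric.sphere (0 : EuclideanSpace ℝ V) 1 ∩ sumZero V) :=
    (isCompact_sphere _ _).inter_right (Submodule.closed_of_finiteDimensional _)
  have hne : sumZero V ≠ ⊥ := by
    intro h
    have h1 := finrank_sumZero (V := V)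
    rw [h, finrank_bot] at h1
    have := Fintype.one_lt_card (α := V)
    omega
  obtain ⟨x, hx, hx0⟩ := Submodule.exists_mem_ne_zero_of_ne_bot hne
  have hcont : Continuous fun x : EuclideanSpace ℝ V => ⟪adjOp G x, x⟫_ℝ :=
    ((adjOp G).continuous_of_finiteDimensional).inner continuous_id
  have hscale : ∀ x ∈ sumZero V, x ≠ 0 →
      (‖x‖⁻¹ • x) ∈ Metric.sphere (0 : EuclideanSpace ℝ V) 1 ∩ sumZero V := fun x hx hx0 =>
    ⟨by simp [norm_smul, hx0], Submodule.smul_mem _ _ hx⟩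
  obtain ⟨z, hz, hmin⟩ := hcomp.exists_isMinOn ⟨_, hscale x hx hx0⟩ hcont.continuousOn
  have hf : Feasible G ⟪adjOp G z, z⟫_ℝ := by
    intro y hy
    by_cases hy0 : y = 0
    · simp [hy0]
    have := hmin (hscale y hy hy0)
    simp only [Set.mem_ofPred_eq, map_smul, real_inner_smul_left, real_inner_smul_right] at this
    have hpos : 0 < ‖y‖ := norm_pos_iff.2 hy0
    field_simp at this
    exact this
  refine ⟨_, hf, Submodule.ne_bot_iff _ |>.2 ⟨z, hf.mem_radical_iff.2 ⟨hz.2, ?_⟩, ?_⟩⟩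
  · have : ‖z‖ = 1 := by simpa using hz.1
    rw [this]; ring
  · rintro rfl
    simpa using hz.1

end

/-! ### Disjoint unions of cliques, given as the blocks of a vertex labelling -/

section Blocks

variable {V C : Type*} [Fintype V] [DecidableEq C] {κ : V → C}

/-- The sum of the coordinates in a block. -/
noncomputable def blockSum (κ : V → C) (x : EuclideanSpace ℝ V) (c : C) : ℝ :=
  ∑ u with κ u = c, x u

/-- The sum of the squared coordinates in a block. -/
noncomputable def blockSq (κ : V → C) (x : EuclideanSpace ℝ V) (c : C) : ℝ :=
  ∑ u with κ u = c, x u ^ 2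

/-- The number of vertices in a block. -/
def blockSize (κ : V → C) (c : C) : ℕ := (Finset.univ.filter fun u => κ u = c).card

theorem blockSq_nonneg (x : EuclideanSpace ℝ V) (c : C) : 0 ≤ blockSq κ x c :=
  Finset.sum_nonneg fun _ _ => sq_nonneg _

theorem blockSum_sq_le (x : EuclideanSpace ℝ V) (c : C) :
    blockSum κ x c ^ 2 ≤ blockSize κ c * blockSq κ x c :=
  sq_sum_le_card_mul_sum_sq

theorem eq_of_blockSq_eq_zero {x : EuclideanSpace ℝ V} {c : C} (h : blockSq κ x c = 0) {u : V}
    (hu : κ u = c) : x u = 0 := by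
  have := (Finset.sum_eq_zero_iff_of_nonneg fun _ _ => sq_nonneg _).1 h u (by simp [hu])
  exact pow_eq_zero_iff two_ne_zero |>.1 this

theorem eq_of_blockSum_sq_eq {x : EuclideanSpace ℝ V} {c : C}
    (h : blockSum κ x c ^ 2 = blockSize κ c * blockSq κ x c) {u : V}
    (hu : κ u = c) : blockSize κ c * x u = blockSum κ x c := by
  -- Variance identity: the defect in Cauchy–Schwarz is a sum of squared deviations from the block
  -- mean, so equality forces a constant block.
  have e : ∑ v with κ v = c, (blockSize κ c * x v - blockSum κ x c) ^ 2 =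
      blockSize κ c * (blockSize κ c * blockSq κ x c - blockSum κ x c ^ 2) := by
    simp only [sub_sq, Finset.sum_add_distrib, Finset.sum_sub_distrib, mul_pow, ← Finset.mul_sum,
      ← Finset.sum_mul, Finset.sum_const, nsmul_eq_mul]
    change _ * blockSq κ x c - 2 * (_ * blockSum κ x c) * _ + blockSize κ c * _ = _
    ring
  rw [h, sub_self, mul_zero] at e
  have := (Finset.sum_eq_zero_iff_of_nonneg fun _ _ => sq_nonneg _).1 e u (by simp [hu])
  exact sub_eq_zero.1 (pow_eq_zero_iff two_ne_zero |>.1 this)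

variable [Fintype C]

theorem sum_blockSq (x : EuclideanSpace ℝ V) : ∑ c, blockSq κ x c = ‖x‖ ^ 2 := by
  rw [EuclideanSpace.real_norm_sq_eq]
  exact Finset.sum_fiberwise _ κ _

theorem sum_blockSum (x : EuclideanSpace ℝ V) : ∑ c, blockSum κ x c = ∑ v, x v :=
  Finset.sum_fiberwise _ κ _

theorem sum_blockSum_mul (x y : EuclideanSpace ℝ V) :
    ∑ c, blockSum κ x c * blockSum κ y c =
      ∑ u, ∑ v, x u * y v * (if κ u = κ v then 1 else 0) := by
  have : ∀ c, blockSum κ x c * blockSum κ y c =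
      ∑ u with κ u = c, ∑ v, x u * y v * (if κ u = κ v then 1 else 0) := fun c => by
    rw [blockSum, Finset.sum_mul]
    refine Finset.sum_congr rfl fun u hu => ?_
    rw [(Finset.mem_filter.1 hu).2, blockSum, Finset.mul_sum, Finset.sum_filter]
    refine Finset.sum_congr rfl fun v _ => ?_
    by_cases h : κ v = c
    · simp [h]
    · simp [h, Ne.symm h]
  simp only [this]
  exact Finset.sum_fiberwise _ κ _

variable [DecidableEq V] {G : SimpleGraph V} [DecidableRel G.Adj]

/-- A + I is the block-diagonal matrix with an all-ones block for each clique. -/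
theorem inner_adjOp_of_blocks (hκ : ∀ u v, G.Adj u v ∨ u = v ↔ κ u = κ v)
    (x y : EuclideanSpace ℝ V) :
    ⟪adjOp G x, y⟫_ℝ = ∑ c, blockSum κ x c * blockSum κ y c - ⟪x, y⟫_ℝ := by
  rw [sum_blockSum_mul, inner_adjOp, inner_eq_sum_ite, ← Finset.sum_sub_distrib]
  refine Finset.sum_congr rfl fun u _ => ?_
  rw [← Finset.sum_sub_distrib]
  refine Finset.sum_congr rfl fun v _ => ?_
  rw [← mul_sub, ← if_congr (hκ u v) rfl rfl]
  by_cases h : u = v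
  · subst h; simp
  · simp [h]

/-- The two adjacency matrices and the identity add up to the all-ones matrix, whose form vanishes
once one argument has sum zero. -/
theorem inner_adjOp_compl {x y : EuclideanSpace ℝ V} (hx : x ∈ sumZero V) :
    ⟪adjOp Gᶜ x, y⟫_ℝ = - ⟪adjOp G x, y⟫_ℝ - ⟪x, y⟫_ℝ := by
  have h0 : ∑ u, ∑ v, x u * y v = 0 := by
    rw [← Finset.sum_mul_sum, mem_sumZero.1 hx, zero_mul]
  have key : ⟪adjOp Gᶜ x, y⟫_ℝ + ⟪adjOp G x, y⟫_ℝ + ⟪x, y⟫_ℝ = ∑ u, ∑ v, x u * y v := by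
    rw [inner_adjOp, inner_adjOp, inner_eq_sum_ite]
    simp only [← Finset.sum_add_distrib]
    refine Finset.sum_congr rfl fun u _ => Finset.sum_congr rfl fun v _ => ?_
    by_cases h : u = v
    · subst h; simp
    · by_cases ha : G.Adj u v <;> simp [h, ha]
  linarith

theorem isMaxNullity_zero_of_blocks (hκ : ∀ u v, G.Adj u v ∨ u = v ↔ κ u = κ v) :
    IsMaxNullity G 0 := by
  have key : ∀ x, - ‖x‖ ^ 2 ≤ ⟪adjOp G x, x⟫_ℝ := fun x => by
    rw [inner_adjOp_of_blocks hκ, real_inner_self_eq_norm_sq]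
    have : 0 ≤ ∑ c, blockSum κ x c * blockSum κ x c :=
      Finset.sum_nonneg fun _ _ => mul_self_nonneg _
    linarith
  have hz : ∀ μ < -1, Feasible G μ → radical G μ = ⊥ := by
    intro μ hμ hf
    rw [Submodule.eq_bot_iff]
    intro x hx
    have h1 := (hf.mem_radical_iff.1 hx).2
    have h2 := key x
    by_contra hne
    have : 0 < ‖x‖ ^ 2 := by positivity
    nlinarith
  -- Only one admissible parameter is needed as a witness; any value below -1 would serve.
  have hf : Feasible G (-2) := fun x _ => by
    have := key x
    have := sq_nonneg ‖x‖
    linarith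
  refine ⟨fun μ hμ hf => by rw [hz μ hμ hf, finrank_bot], -2, by norm_num, hf, ?_⟩
  rw [hz _ (by norm_num) hf, finrank_bot]

theorem inner_adjOp_compl_of_blocks (hκ : ∀ u v, G.Adj u v ∨ u = v ↔ κ u = κ v)
    {x : EuclideanSpace ℝ V} (hx : x ∈ sumZero V) :
    ⟪adjOp Gᶜ x, x⟫_ℝ = - ∑ c, blockSum κ x c ^ 2 := by
  rw [inner_adjOp_compl hx, inner_adjOp_of_blocks hκ]
  simp only [sq]
  ring

/-- The vector with prescribed values on the blocks of `s`, vanishing elsewhere. -/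
noncomputable def blockVector (κ : V → C) (s : Finset C) :
    (s → ℝ) →ₗ[ℝ] EuclideanSpace ℝ V where
  toFun f := WithLp.toLp 2 fun u => if h : κ u ∈ s then f ⟨κ u, h⟩ else 0
  map_add' f g := by ext u; by_cases h : κ u ∈ s <;> simp [h]
  map_smul' t f := by ext u; by_cases h : κ u ∈ s <;> simp [h]

/-- A disjoint union of cliques with several largest cliques. -/
theorem isMaxNullity_compl_of_blocks_of_two_le
    (hκ : ∀ u v, G.Adj u v ∨ u = v ↔ κ u = κ v) (hsurj : Function.Surjective κ)
    {N : ℕ} (hN : 2 ≤ N) (hle : ∀ c, blockSize κ c ≤ N)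
    (hcard : 2 ≤ (Finset.univ.filter fun c => blockSize κ c = N).card) :
    IsMaxNullity Gᶜ ((Finset.univ.filter fun c => blockSize κ c = N).card - 1) := by
  set s := Finset.univ.filter fun c => blockSize κ c = N with hs
  have hmem : ∀ c, c ∈ s ↔ blockSize κ c = N := fun c => by simp [hs]
  have hN0 : (N : ℝ) ≠ 0 := by positivity
  have hterm : ∀ x : EuclideanSpace ℝ V, ∀ c, blockSum κ x c ^ 2 ≤ N * blockSq κ x c :=
    fun x c => (blockSum_sq_le x c).trans
      (mul_le_mul_of_nonneg_right (by exact_mod_cast hle c) (blockSq_nonneg x c))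
  have hf : Feasible Gᶜ (-N) := fun x hx => by
    rw [inner_adjOp_compl_of_blocks hκ hx, ← sum_blockSq (κ := κ), neg_mul, neg_le_neg_iff,
      Finset.mul_sum]
    exact Finset.sum_le_sum fun c _ => hterm x c
  have hinj : Function.Injective (blockVector κ s) := by
    intro f g h
    funext ⟨c, hc⟩
    obtain ⟨u, rfl⟩ := hsurj c
    have := congrFun (congrArg WithLp.ofLp h) u
    simpa [blockVector, hc] using this
  -- Equality must hold blockwise: it forces `x` to be constant on each largest block and, since a
  -- smaller size leaves slack, zero on all others.
  have hrad : radical Gᶜ (-N) = LinearMap.range (blockVector κ s) ⊓ sumZero V := by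
    ext x
    rw [hf.mem_radical_iff, Submodule.mem_inf, and_comm]
    refine and_congr_left fun hx => ?_
    rw [inner_adjOp_compl_of_blocks hκ hx, ← sum_blockSq (κ := κ), neg_mul, neg_inj,
      Finset.mul_sum]
    constructor
    · intro h
      have heq := fun c => (Finset.sum_eq_sum_iff_of_le fun c _ => hterm x c).1 h c
        (Finset.mem_univ c)
      refine ⟨fun c => blockSum κ x c / N, ?_⟩
      ext u
      by_cases hu : blockSize κ (κ u) = N
      · have := eq_of_blockSum_sq_eq (x := x) (c := κ u) (by rw [hu]; exact heq _) rfl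
        rw [hu] at this
        simp only [blockVector, LinearMap.coe_mk, AddHom.coe_mk, hmem, hu, dif_pos, ← this]
        field_simp
      · simp only [blockVector, LinearMap.coe_mk, AddHom.coe_mk, hmem, hu, dif_neg,
          not_false_eq_true]
        refine (eq_of_blockSq_eq_zero (x := x) (c := κ u) ?_ rfl).symm
        have h1 := heq (κ u)
        have h2 := blockSum_sq_le (κ := κ) x (κ u)
        have h3 : ((blockSize κ (κ u) : ℕ) : ℝ) < N := by
          exact_mod_cast lt_of_le_of_ne (hle _) hu
        have h4 := blockSq_nonneg (κ := κ) x (κ u)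
        nlinarith
    · rintro ⟨f, rfl⟩
      refine Finset.sum_congr rfl fun c _ => ?_
      by_cases hc : c ∈ s
      · have h1 : ∀ u, κ u = c → blockVector κ s f u = f ⟨c, hc⟩ := by
          rintro u rfl
          simp [blockVector, hc]
        have h2 : blockSum κ (blockVector κ s f) c = N * f ⟨c, hc⟩ := by
          rw [blockSum, Finset.sum_congr rfl fun u hu => h1 u (Finset.mem_filter.1 hu).2,
            Finset.sum_const, nsmul_eq_mul, ← (hmem c).1 hc]
          rfl
        have h3 : blockSq κ (blockVector κ s f) c = N * f ⟨c, hc⟩ ^ 2 := by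
          rw [blockSq, Finset.sum_congr rfl fun u hu => by rw [h1 u (Finset.mem_filter.1 hu).2],
            Finset.sum_const, nsmul_eq_mul, ← (hmem c).1 hc]
          rfl
        rw [h2, h3]; ring
      · have h1 : ∀ u, κ u = c → blockVector κ s f u = 0 := by
          rintro u rfl
          simp [blockVector, hc]
        rw [blockSum, blockSq, Finset.sum_eq_zero fun u hu => h1 u (Finset.mem_filter.1 hu).2,
          Finset.sum_eq_zero fun u hu => by rw [h1 u (Finset.mem_filter.1 hu).2]; norm_num]
        norm_num
  have hnot : ¬ LinearMap.range (blockVector κ s) ≤ sumZero V := by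
    intro h
    obtain ⟨c, hc⟩ : s.Nonempty := Finset.card_pos.1 (by omega)
    obtain ⟨u, rfl⟩ := hsurj c
    have := mem_sumZero.1 (h ⟨fun _ => 1, rfl⟩)
    rw [Finset.sum_eq_zero_iff_of_nonneg] at this
    · simpa [blockVector, hc] using this u (Finset.mem_univ u)
    · intro v _
      by_cases hv : κ v ∈ s <;> simp [blockVector, hv]
  have hfin := finrank_inf_sumZero hnot
  rw [← hrad, LinearMap.finrank_range_of_inj hinj, Module.finrank_fintype_fun_eq_card,
    Fintype.card_coe] at hfin
  have hres : Module.finrank ℝ (radical Gᶜ (-N)) = s.card - 1 := by omega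
  rw [← hres]
  refine hf.isMaxNullity ?_ ?_
  · have : (2 : ℝ) ≤ N := by exact_mod_cast hN
    linarith
  · intro h
    rw [h, finrank_bot] at hres
    omega

/-- A disjoint union of cliques with a unique largest clique. -/
theorem isMaxNullity_compl_of_blocks_of_unique [Nontrivial V]
    (hκ : ∀ u v, G.Adj u v ∨ u = v ↔ κ u = κ v) {c₁ c₂ : C} (hne : c₂ ≠ c₁)
    (h₂ : 1 ≤ blockSize κ c₂) (h₁₂ : blockSize κ c₂ < blockSize κ c₁)
    (hle : ∀ c ≠ c₁, blockSize κ c ≤ blockSize κ c₂) : IsMaxNullity Gᶜ 1 := by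
  obtain ⟨μ, hf, h0⟩ := exists_feasible_radical_ne_bot Gᶜ
  set a : ℝ := ((blockSize κ c₁ : ℕ) : ℝ) with ha
  set b : ℝ := ((blockSize κ c₂ : ℕ) : ℝ) with hb
  have hb1 : 1 ≤ b := by rw [hb]; exact_mod_cast h₂
  have hab : b < a := by rw [ha, hb]; exact_mod_cast h₁₂
  have hμ : μ < -b := by
    -- A balanced vector on the two blocks: its form is -2a²b² and its squared norm ab(a + b). The
    -- Rayleigh quotient -2ab/(a + b) is below -b because b < a.
    let z : EuclideanSpace ℝ V := WithLp.toLp 2 fun u =>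
      if κ u = c₁ then b else if κ u = c₂ then -a else 0
    have hz1 : ∀ u, κ u = c₁ → z u = b := fun u hu => by simp [z, hu]
    have hz2 : ∀ u, κ u = c₂ → z u = -a := fun u hu => by simp [z, hu, hne]
    have hz3 : ∀ c, c ≠ c₁ ∧ c ≠ c₂ → ∀ u, κ u = c → z u = 0 := by
      rintro c ⟨h1, h2⟩ u rfl
      simp [z, h1, h2]
    have hs1 : blockSum κ z c₁ = a * b := by
      rw [blockSum, Finset.sum_congr rfl fun u hu => hz1 u (Finset.mem_filter.1 hu).2,
        Finset.sum_const, nsmul_eq_mul]; rfl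
    have hs2 : blockSum κ z c₂ = b * -a := by
      rw [blockSum, Finset.sum_congr rfl fun u hu => hz2 u (Finset.mem_filter.1 hu).2,
        Finset.sum_const, nsmul_eq_mul]; rfl
    have hs3 : ∀ c, c ≠ c₁ ∧ c ≠ c₂ → blockSum κ z c = 0 := fun c hc =>
      Finset.sum_eq_zero fun u hu => hz3 c hc u (Finset.mem_filter.1 hu).2
    have hq1 : blockSq κ z c₁ = a * b ^ 2 := by
      rw [blockSq, Finset.sum_congr rfl fun u hu => by rw [hz1 u (Finset.mem_filter.1 hu).2],
        Finset.sum_const, nsmul_eq_mul]; rfl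
    have hq2 : blockSq κ z c₂ = b * (-a) ^ 2 := by
      rw [blockSq, Finset.sum_congr rfl fun u hu => by rw [hz2 u (Finset.mem_filter.1 hu).2],
        Finset.sum_const, nsmul_eq_mul]; rfl
    have hq3 : ∀ c, c ≠ c₁ ∧ c ≠ c₂ → blockSq κ z c = 0 := fun c hc =>
      Finset.sum_eq_zero fun u hu => by rw [hz3 c hc u (Finset.mem_filter.1 hu).2]; norm_num
    have hzU : z ∈ sumZero V := by
      rw [mem_sumZero, ← sum_blockSum (κ := κ), Fintype.sum_eq_add c₁ c₂ hne.symm hs3, hs1, hs2]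
      ring
    have hfz := hf z hzU
    rw [inner_adjOp_compl_of_blocks hκ hzU, ← sum_blockSq (κ := κ),
      Fintype.sum_eq_add c₁ c₂ hne.symm hq3,
      Fintype.sum_eq_add c₁ c₂ hne.symm (fun c hc => by rw [hs3 c hc]; norm_num),
      hs1, hs2, hq1, hq2] at hfz
    by_contra! hcon
    have hab0 : 0 < a * b := by nlinarith
    have h1 : 0 < a * b * (a + b) := by nlinarith
    have h2 : 0 < a * b * (b * (a - b)) := by
      apply mul_pos hab0; nlinarith
    nlinarith [mul_le_mul_of_nonneg_right hcon h1.le]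
  -- If the largest block has sum zero, Cauchy–Schwarz on the others keeps the form at least -b‖x‖²,
  -- above `μ`‖x‖² unless x = 0. One linear functional thus separates points of the radical.
  have hker : ∀ x ∈ radical Gᶜ μ, blockSum κ x c₁ = 0 → x = 0 := by
    intro x hx hx1
    have h1 := (hf.mem_radical_iff.1 hx).2
    rw [inner_adjOp_compl_of_blocks hκ hx.1] at h1
    have h2 : ∑ c, blockSum κ x c ^ 2 ≤ b * ‖x‖ ^ 2 := by
      rw [← sum_blockSq (κ := κ), Finset.mul_sum]
      refine Finset.sum_le_sum fun c _ => ?_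
      by_cases hc : c = c₁
      · rw [hc, hx1]
        have := blockSq_nonneg (κ := κ) x c₁
        nlinarith
      · exact (blockSum_sq_le x c).trans
          (mul_le_mul_of_nonneg_right (by rw [hb]; exact_mod_cast hle c hc) (blockSq_nonneg x c))
    by_contra hne
    have : 0 < ‖x‖ ^ 2 := by positivity
    nlinarith
  let f : radical Gᶜ μ →ₗ[ℝ] ℝ :=
    { toFun := fun x => blockSum κ x c₁
      map_add' := fun x y => by simp [blockSum, Finset.sum_add_distrib]
      map_smul' := fun t x => by simp [blockSum, Finset.mul_sum] }
  have hinj : Function.Injective f := by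
    rw [← LinearMap.ker_eq_bot, Submodule.eq_bot_iff]
    intro x hx
    exact Subtype.ext (hker x x.2 hx)
  have hle1 := LinearMap.finrank_le_finrank_of_injective hinj
  rw [Module.finrank_self] at hle1
  have hpos : 0 < Module.finrank ℝ (radical Gᶜ μ) :=
    Nat.pos_of_ne_zero fun h => h0 (Submodule.finrank_eq_zero.1 h)
  have h := hf.isMaxNullity (by linarith) h0
  rwa [le_antisymm hle1 hpos] at h

end Blocks

/-! ### Connected components as blocks -/

section Components

variable {V : Type*} {G : SimpleGraph V}

theorem adj_or_eq_iff_of_isClique (h : ∀ c : G.ConnectedComponent, G.IsClique c.supp) (u v : V) :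
    G.Adj u v ∨ u = v ↔ G.connectedComponentMk u = G.connectedComponentMk v := by
  constructor
  · rintro (h | rfl)
    · exact SimpleGraph.ConnectedComponent.sound h.reachable
    · rfl
  · intro huv
    by_cases he : u = v
    · exact Or.inr he
    · exact Or.inl (h (G.connectedComponentMk v) huv rfl he)

variable [Fintype V] [DecidableEq V] [DecidableRel G.Adj]

theorem isMaxNullity_zero_of_isClique
    (h : ∀ c : G.ConnectedComponent, G.IsClique c.supp) : IsMaxNullity G 0 := by
  classical
  exact isMaxNullity_zero_of_blocks (adj_or_eq_iff_of_isClique h)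

theorem isMaxNullity_compl_of_isDisjointUnionOfCliques (h : IsDisjointUnionOfCliques G)
    (hG : Gᶜ ≠ ⊤) : IsMaxNullity Gᶜ (max (numLargestComponents G) 2 - 1) := by
  classical
  have hκ := adj_or_eq_iff_of_isClique h.1
  set κ := G.connectedComponentMk with hκdef
  have hsurj : Function.Surjective κ := fun c => c.exists_rep
  have hsize : ∀ c, c.supp.ncard = blockSize κ c := fun c => by
    rw [blockSize, ← Set.ncard_coe_finset]
    congr 1
    ext u
    simp [hκdef]
  have hcard : 2 ≤ Fintype.card G.ConnectedComponent := by
    rw [← Nat.card_eq_fintype_card]; exact h.2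
  have : Nontrivial G.ConnectedComponent := Fintype.one_lt_card_iff_nontrivial.1 hcard
  have : Nontrivial V := hsurj.nontrivial
  obtain ⟨c₁, hc₁⟩ := Finite.exists_max (blockSize κ)
  have hnum : numLargestComponents G =
      (Finset.univ.filter fun c => blockSize κ c = blockSize κ c₁).card := by
    rw [numLargestComponents, ← Set.ncard_coe_finset]
    congr 1
    ext c
    simp only [hsize, Set.mem_ofPred_eq, Finset.coe_filter, Finset.mem_univ, true_and]
    exact ⟨fun hc => le_antisymm (hc₁ c) (hc c₁), fun hc d => hc ▸ hc₁ d⟩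
  -- `G` has an edge because its complement is not complete; this puts the parameter -N, with N the
  -- largest clique size, below -1.
  have hN : 2 ≤ blockSize κ c₁ := by
    obtain ⟨u, v, huv⟩ : ∃ u v, G.Adj u v := by
      by_contra! hcon
      apply hG
      ext u v
      simp [hcon]
    refine le_trans ?_ (hc₁ (κ u))
    rw [← Finset.card_pair huv.ne]
    refine Finset.card_le_card fun w hw => ?_
    rcases Finset.mem_insert.1 hw with rfl | hw
    · simp
    · rw [Finset.mem_singleton.1 hw]
      simpa using ((hκ u v).1 (Or.inl huv)).symm
  rw [hnum]
  by_cases h2 : 2 ≤ (Finset.univ.filter fun c => blockSize κ c = blockSize κ c₁).card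
  · rw [max_eq_left h2]
    exact isMaxNullity_compl_of_blocks_of_two_le hκ hsurj hN hc₁ h2
  · rw [max_eq_right (by omega)]
    have huniq : ∀ c ≠ c₁, blockSize κ c ≠ blockSize κ c₁ := by
      intro c hc he
      apply h2
      rw [← Finset.card_pair hc]
      refine Finset.card_le_card fun d hd => ?_
      rcases Finset.mem_insert.1 hd with rfl | hd
      · simp [he]
      · simp [Finset.mem_singleton.1 hd]
    obtain ⟨c', hc'⟩ := exists_ne c₁
    obtain ⟨c₂, hc₂, hmax⟩ := (Finset.univ.filter fun c => c ≠ c₁).exists_max_image (blockSize κ)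
      ⟨c', by simp [hc']⟩
    have hne : c₂ ≠ c₁ := (Finset.mem_filter.1 hc₂).2
    refine isMaxNullity_compl_of_blocks_of_unique hκ hne ?_
      (lt_of_le_of_ne (hc₁ _) (huniq _ hne)) fun c hc => hmax c (by simp [hc])
    obtain ⟨u, rfl⟩ := hsurj c₂
    exact Finset.card_pos.2 ⟨u, by simp⟩

end Components

/-! ### Induced paths and the bound below -1 -/

section InducedPath

variable {V : Type*} {G : SimpleGraph V}

/-- A graph with a component that is not a clique has an induced path on three vertices. -/
theorem exists_induced_path (h : ¬ ∀ c : G.ConnectedComponent, G.IsClique c.supp) :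
    ∃ u v w, G.Adj u v ∧ G.Adj v w ∧ u ≠ w ∧ ¬ G.Adj u w := by
  by_contra! hcon
  refine h fun c u hu v hv huv => ?_
  have hr : G.Reachable u v := SimpleGraph.ConnectedComponent.exact (hu.trans hv.symm)
  obtain ⟨p⟩ := hr
  -- Without induced paths on three vertices adjacency is transitive on distinct vertices, so a walk
  -- shortcuts to one edge.
  have key : ∀ {a b : V} (_ : G.Walk a b), a ≠ b → G.Adj a b := by
    intro a b p
    induction p with
    | nil => exact fun h => (h rfl).elim
    | @cons a b c hab p ih =>
      intro hac
      by_cases hbc : b = c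
      · exact hbc ▸ hab
      · exact hcon a b c hab (ih hbc) hac
  exact key p huv

variable [Fintype V] [DecidableEq V] [DecidableRel G.Adj]

theorem Feasible.lt_neg_one (h : ¬ ∀ c : G.ConnectedComponent, G.IsClique c.supp) {μ : ℝ}
    (hf : Feasible G μ) : μ < -1 := by
  obtain ⟨u, v, w, huv, hvw, huw, hn⟩ := exists_induced_path h
  -- The weights 1, -2, 1 along the path have sum zero and Rayleigh quotient -8/6, below -1.
  set x : EuclideanSpace ℝ V := EuclideanSpace.single u 1 + EuclideanSpace.single w 1 -
    (2 : ℝ) • EuclideanSpace.single v 1 with hx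
  have hxU : x ∈ sumZero V := by
    rw [mem_sumZero]
    simp [hx, Finset.sum_add_distrib]
    norm_num
  have h1 := hf x hxU
  have e1 := huv.ne
  have e2 := hvw.ne
  have e1' := e1.symm
  have e2' := e2.symm
  have e3' := huw.symm
  have a1 := huv.symm
  have a2 := hvw.symm
  have hn' : ¬ G.Adj w u := fun h => hn h.symm
  have hA : ⟪adjOp G x, x⟫_ℝ = -8 := by
    simp only [hx, map_sub, map_add, map_smul, inner_sub_left, inner_sub_right, inner_add_left,
      inner_add_right, real_inner_smul_left, real_inner_smul_right, inner_adjOp_single, huv, hvw,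
      hn, hn', a1, a2, SimpleGraph.irrefl, if_true, if_false]
    norm_num
  have hI : ‖x‖ ^ 2 = 6 := by
    rw [← real_inner_self_eq_norm_sq]
    simp only [hx, inner_sub_left, inner_sub_right, inner_add_left,
      inner_add_right, real_inner_smul_left, real_inner_smul_right,
      EuclideanSpace.inner_single_left, PiLp.single_apply, e2, e1', e3', huw, if_true,
      if_false, map_one]
    norm_num [e1, e2']
  rw [hA, hI] at h1
  linarith

end InducedPath

/-! ### Spectral decomposition and main angles -/

section Spectral

variable {V : Type*} [Fintype V] [DecidableEq V] (G : SimpleGraph V) [DecidableRel G.Adj]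

/-- The component of a vector in the `i`-th eigenspace. -/
noncomputable def proj (i : ℕ) : EuclideanSpace ℝ V →ₗ[ℝ] EuclideanSpace ℝ V :=
  (eigenSubspace G i).starProjection.toLinearMap

/-- The component of the all-ones vector in the `i`-th eigenspace. -/
noncomputable def onesProj (i : ℕ) : EuclideanSpace ℝ V :=
  proj G i (WithLp.toLp 2 (fun _ : V => (1 : ℝ)))

theorem proj_mem (i : ℕ) (x : EuclideanSpace ℝ V) : proj G i x ∈ eigenSubspace G i :=
  Submodule.starProjection_apply_mem _ x

theorem proj_eq_self {i : ℕ} {x : EuclideanSpace ℝ V} (hx : x ∈ eigenSubspace G i) :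
    proj G i x = x :=
  Submodule.starProjection_eq_self_iff.2 hx

theorem proj_isSymmetric (i : ℕ) : (proj G i).IsSymmetric := fun x y =>
  Submodule.inner_starProjection_left_eq_right _ x y

variable {G}

theorem eigenvalue_lt {i j : ℕ} (hi : 1 ≤ i) (hij : i < j) (hj : j ≤ numEigenvalues G) :
    eigenvalue G i < eigenvalue G j := by
  rw [eigenvalue, dif_pos ⟨hi, by omega⟩, eigenvalue, dif_pos ⟨by omega, hj⟩]
  exact ((eigenvalueSet G).orderEmbOfFin (k := numEigenvalues G) rfl).strictMono
    (Fin.mk_lt_mk.2 (by omega))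

theorem eigenvalue_ne {i j : ℕ} (hi : i ∈ Finset.Icc 1 (numEigenvalues G))
    (hj : j ∈ Finset.Icc 1 (numEigenvalues G)) (hij : i ≠ j) :
    eigenvalue G i ≠ eigenvalue G j := by
  rw [Finset.mem_Icc] at hi hj
  rcases lt_or_gt_of_ne hij with h | h
  · exact (eigenvalue_lt hi.1 h hj.2).ne
  · exact (eigenvalue_lt hj.1 h hi.2).ne'

theorem hasEigenvalue_iff {μ : ℝ} : (adjOp G).HasEigenvalue μ ↔
    ∃ i ∈ Finset.Icc 1 (numEigenvalues G), eigenvalue G i = μ := by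
  have h1 : (adjOp G).HasEigenvalue μ ↔ μ ∈ eigenvalueSet G := by
    simp [eigenvalueSet]
  rw [h1, ← Finset.mem_coe,
    ← (eigenvalueSet G).range_orderEmbOfFin (k := numEigenvalues G) rfl]
  constructor
  · rintro ⟨k, rfl⟩
    have hk := k.2
    refine ⟨k + 1, Finset.mem_Icc.2 ⟨by omega, by omega⟩, ?_⟩
    rw [eigenvalue, dif_pos ⟨by omega, by omega⟩]
    rfl
  · rintro ⟨i, hi, rfl⟩
    have hi' := Finset.mem_Icc.1 hi
    rw [eigenvalue, dif_pos hi']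
    exact ⟨_, rfl⟩

theorem eigenSubspace_ne_bot {i : ℕ} (hi : i ∈ Finset.Icc 1 (numEigenvalues G)) :
    eigenSubspace G i ≠ ⊥ :=
  hasEigenvalue_iff.2 ⟨i, hi, rfl⟩

theorem inner_eigenSubspace {i j : ℕ} (hi : i ∈ Finset.Icc 1 (numEigenvalues G))
    (hj : j ∈ Finset.Icc 1 (numEigenvalues G)) (hij : i ≠ j) {x y : EuclideanSpace ℝ V}
    (hx : x ∈ eigenSubspace G i) (hy : y ∈ eigenSubspace G j) : ⟪x, y⟫_ℝ = 0 :=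
  (adjOp_isSymmetric G).orthogonalFamily_eigenspaces (eigenvalue_ne hi hj hij) ⟨x, hx⟩ ⟨y, hy⟩

theorem proj_of_mem_ne {i j : ℕ} (hi : i ∈ Finset.Icc 1 (numEigenvalues G))
    (hj : j ∈ Finset.Icc 1 (numEigenvalues G)) (hij : i ≠ j) {x : EuclideanSpace ℝ V}
    (hx : x ∈ eigenSubspace G i) : proj G j x = 0 := by
  rw [← inner_self_eq_zero (𝕜 := ℝ), proj_isSymmetric, proj_eq_self G (proj_mem G j x)]
  exact inner_eigenSubspace hi hj hij hx (proj_mem G j x)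

theorem sum_proj (x : EuclideanSpace ℝ V) :
    ∑ i ∈ Finset.Icc 1 (numEigenvalues G), proj G i x = x := by
  have hfam : OrthogonalFamily ℝ
      (fun i : Finset.Icc 1 (numEigenvalues G) => eigenSubspace G i)
      fun i => (eigenSubspace G i).subtypeₗᵢ := by
    intro i j hij a b
    exact inner_eigenSubspace i.2 j.2 (fun h => hij (Subtype.ext h)) a.2 b.2
  have htop : (⨆ i : Finset.Icc 1 (numEigenvalues G), eigenSubspace G i) = ⊤ := by
    rw [← Submodule.orthogonal_eq_bot_iff, eq_bot_iff,
      ← (adjOp_isSymmetric G).orthogonalComplement_iSup_eigenspaces_eq_bot]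
    refine Submodule.orthogonal_le (iSup_le fun μ => ?_)
    by_cases h : (adjOp G).HasEigenvalue μ
    · obtain ⟨i, hi, rfl⟩ := hasEigenvalue_iff.1 h
      exact le_iSup (fun i : Finset.Icc 1 (numEigenvalues G) => eigenSubspace G i) ⟨i, hi⟩
    · have : (adjOp G).eigenspace μ = ⊥ := not_not.1 h
      rw [this]; exact bot_le
  have := hfam.sum_projection_of_mem_iSup x (by rw [htop]; trivial)
  rw [← Finset.sum_coe_sort]
  exact this

theorem inner_eq_sum_proj (x y : EuclideanSpace ℝ V) :
    ⟪x, y⟫_ℝ = ∑ i ∈ Finset.Icc 1 (numEigenvalues G), ⟪proj G i x, proj G i y⟫_ℝ := by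
  conv_lhs => rw [← sum_proj (G := G) x, sum_inner]
  refine Finset.sum_congr rfl fun i _ => ?_
  rw [proj_isSymmetric, proj_isSymmetric, proj_eq_self G (proj_mem G i y)]

theorem form_eq_sum_proj (μ : ℝ) (x : EuclideanSpace ℝ V) :
    ⟪adjOp G x, x⟫_ℝ - μ * ‖x‖ ^ 2 =
      ∑ i ∈ Finset.Icc 1 (numEigenvalues G), (eigenvalue G i - μ) * ‖proj G i x‖ ^ 2 := by
  have h1 : ⟪adjOp G x, x⟫_ℝ =
      ∑ i ∈ Finset.Icc 1 (numEigenvalues G), eigenvalue G i * ‖proj G i x‖ ^ 2 := by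
    conv_lhs => rw [← sum_proj (G := G) x, map_sum, sum_inner]
    refine Finset.sum_congr rfl fun i _ => ?_
    have : adjOp G (proj G i x) = eigenvalue G i • proj G i x :=
      Module.End.mem_eigenspace_iff.1 (proj_mem G i x)
    rw [this, real_inner_smul_left, sum_proj, proj_isSymmetric,
      ← proj_eq_self G (proj_mem G i x), ← proj_isSymmetric, proj_eq_self G (proj_mem G i x),
      real_inner_self_eq_norm_sq]
  rw [h1, ← real_inner_self_eq_norm_sq, inner_eq_sum_proj (G := G), Finset.mul_sum,
    ← Finset.sum_sub_distrib]
  refine Finset.sum_congr rfl fun i _ => ?_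
  rw [real_inner_self_eq_norm_sq]; ring

theorem mem_eigenSubspace_of_proj {i : ℕ} {x : EuclideanSpace ℝ V}
    (h : ∀ j ∈ Finset.Icc 1 (numEigenvalues G), j ≠ i → proj G j x = 0) :
    x ∈ eigenSubspace G i := by
  rw [← sum_proj (G := G) x]
  refine Submodule.sum_mem _ fun j hj => ?_
  by_cases hji : j = i
  · exact hji ▸ proj_mem G j x
  · rw [h j hj hji]; exact zero_mem _

theorem form_of_mem_eigenSubspace {i : ℕ} {x : EuclideanSpace ℝ V} (hx : x ∈ eigenSubspace G i) :
    ⟪adjOp G x, x⟫_ℝ = eigenvalue G i * ‖x‖ ^ 2 := by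
  have : adjOp G x = eigenvalue G i • x := Module.End.mem_eigenspace_iff.1 hx
  rw [this, real_inner_smul_left, real_inner_self_eq_norm_sq]

theorem mem_sumZero_iff_sum_proj {x : EuclideanSpace ℝ V} : x ∈ sumZero V ↔
    ∑ i ∈ Finset.Icc 1 (numEigenvalues G), ⟪proj G i x, onesProj G i⟫_ℝ = 0 := by
  rw [mem_sumZero_iff_inner, inner_eq_sum_proj (G := G)]; rfl

/-- On an eigenspace, pairing with the all-ones vector is pairing with its projection to that
eigenspace. -/
theorem eigenSubspace_le_sumZero_iff {i : ℕ} :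
    eigenSubspace G i ≤ sumZero V ↔ onesProj G i = 0 := by
  constructor
  · intro h
    have := mem_sumZero_iff_inner.1 (h (proj_mem G i (WithLp.toLp 2 (fun _ : V => (1 : ℝ)))))
    rwa [← proj_eq_self G (proj_mem G i _), proj_isSymmetric, inner_self_eq_zero] at this
  · intro h x hx
    rw [mem_sumZero_iff_inner, ← proj_eq_self G hx, proj_isSymmetric]
    change ⟪x, onesProj G i⟫_ℝ = 0
    rw [h, inner_zero_right]

theorem one_le_numEigenvalues [Nonempty V] : 1 ≤ numEigenvalues G := by
  by_contra! h
  obtain ⟨v⟩ := ‹Nonempty V›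
  have := sum_proj (G := G) (EuclideanSpace.single v 1)
  rw [Finset.Icc_eq_empty (by omega), Finset.sum_empty] at this
  have := congrArg norm this
  simp at this

theorem one_mem_Icc [Nonempty V] : 1 ∈ Finset.Icc 1 (numEigenvalues G) :=
  Finset.mem_Icc.2 ⟨le_rfl, one_le_numEigenvalues⟩

theorem feasible_eigenvalue_one : Feasible G (eigenvalue G 1) := by
  intro x _
  rw [← sub_nonneg, form_eq_sum_proj]
  refine Finset.sum_nonneg fun i hi => mul_nonneg ?_ (sq_nonneg _)
  rw [sub_nonneg]
  have hi' := Finset.mem_Icc.1 hi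
  rcases hi'.1.eq_or_lt with h | h
  · rw [h]
  · exact (eigenvalue_lt le_rfl h hi'.2).le

theorem radical_eigenvalue_one : radical G (eigenvalue G 1) = eigenSubspace G 1 ⊓ sumZero V := by
  ext x
  rw [feasible_eigenvalue_one.mem_radical_iff, Submodule.mem_inf, and_comm]
  refine and_congr_left fun _ => ⟨fun h => ?_, form_of_mem_eigenSubspace⟩
  rw [← sub_eq_zero, form_eq_sum_proj, Finset.sum_eq_zero_iff_of_nonneg] at h
  · refine mem_eigenSubspace_of_proj fun j hj hj1 => ?_
    have hj' := Finset.mem_Icc.1 hj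
    have := eigenvalue_lt (G := G) le_rfl (lt_of_le_of_ne hj'.1 hj1.symm) hj'.2
    simpa [sub_eq_zero, this.ne'] using h j hj
  · intro i hi
    refine mul_nonneg ?_ (sq_nonneg _)
    rw [sub_nonneg]
    have hi' := Finset.mem_Icc.1 hi
    rcases hi'.1.eq_or_lt with h | h
    · rw [h]
    · exact (eigenvalue_lt le_rfl h hi'.2).le

theorem sum_Icc_split {M : Type*} [AddCommMonoid M] {s : ℕ} (hs : 2 ≤ s) (f : ℕ → M) :
    ∑ i ∈ Finset.Icc 1 s, f i = f 1 + (f 2 + ∑ i ∈ Finset.Icc 3 s, f i) := by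
  have : Finset.Icc 1 s = insert 1 (insert 2 (Finset.Icc 3 s)) := by
    ext i
    simp only [Finset.mem_Icc, Finset.mem_insert]
    omega
  rw [this, Finset.sum_insert (by simp), Finset.sum_insert (by simp)]

variable (G) in
/-- The unnormalized sum `∑_{i ≥ 3} ‖P_i 𝟏‖² / (τ_i - τ_2)`. -/
noncomputable def resolventSum : ℝ :=
  ∑ i ∈ Finset.Icc 3 (numEigenvalues G), ‖onesProj G i‖ ^ 2 / (eigenvalue G i - eigenvalue G 2)

theorem mainAngle_sq (i : ℕ) :
    mainAngle G i ^ 2 = ‖onesProj G i‖ ^ 2 / Fintype.card V := by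
  change (1 / √(Fintype.card V : ℝ) * ‖onesProj G i‖) ^ 2 = _
  rw [mul_pow, div_pow, Real.sq_sqrt (Nat.cast_nonneg _)]
  ring

theorem mainAngle_eq_zero [Nonempty V] {i : ℕ} : mainAngle G i = 0 ↔ onesProj G i = 0 := by
  rw [← pow_eq_zero_iff two_ne_zero, mainAngle_sq, div_eq_zero_iff]
  simp

theorem lhsTwo_eq : lhsTwo G =
    ‖onesProj G 1‖ ^ 2 / (eigenvalue G 2 - eigenvalue G 1) / Fintype.card V := by
  rw [lhsTwo, mainAngle_sq, div_right_comm]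

theorem rhsTwo_eq : rhsTwo G = resolventSum G / Fintype.card V := by
  rw [rhsTwo, resolventSum, Finset.sum_div]
  refine Finset.sum_congr rfl fun i _ => ?_
  rw [mainAngle_sq, div_right_comm]

theorem eigenvalue_two_lt {i : ℕ} (hi : i ∈ Finset.Icc 3 (numEigenvalues G)) :
    0 < eigenvalue G i - eigenvalue G 2 := by
  rw [Finset.mem_Icc] at hi
  exact sub_pos.2 (eigenvalue_lt (by norm_num) (by omega) hi.2)

/-- The vector `∑ c_i P_i 𝟏`. -/
noncomputable def onesCombo (G : SimpleGraph V) [DecidableRel G.Adj] (c : ℕ → ℝ) :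
    EuclideanSpace ℝ V :=
  ∑ i ∈ Finset.Icc 1 (numEigenvalues G), c i • onesProj G i

theorem proj_onesCombo (c : ℕ → ℝ) {j : ℕ} (hj : j ∈ Finset.Icc 1 (numEigenvalues G)) :
    proj G j (onesCombo G c) = c j • onesProj G j := by
  rw [onesCombo, map_sum, Finset.sum_eq_single j]
  · rw [map_smul, proj_eq_self G (x := onesProj G j) (proj_mem G j _)]
  · intro i hi hij
    rw [map_smul, proj_of_mem_ne hi hj hij (x := onesProj G i) (proj_mem G i _), smul_zero]
  · exact fun h => (h hj).elim

theorem onesCombo_mem_sumZero (c : ℕ → ℝ) : onesCombo G c ∈ sumZero V ↔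
    ∑ i ∈ Finset.Icc 1 (numEigenvalues G), c i * ‖onesProj G i‖ ^ 2 = 0 := by
  rw [mem_sumZero_iff_sum_proj (G := G)]
  refine Eq.congr (Finset.sum_congr rfl fun i hi => ?_) rfl
  rw [proj_onesCombo c hi, real_inner_smul_left, real_inner_self_eq_norm_sq]

theorem form_onesCombo (μ : ℝ) (c : ℕ → ℝ) :
    ⟪adjOp G (onesCombo G c), onesCombo G c⟫_ℝ - μ * ‖onesCombo G c‖ ^ 2 =
      ∑ i ∈ Finset.Icc 1 (numEigenvalues G),
        (eigenvalue G i - μ) * (c i ^ 2 * ‖onesProj G i‖ ^ 2) := by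
  rw [form_eq_sum_proj]
  refine Finset.sum_congr rfl fun i hi => ?_
  rw [proj_onesCombo c hi, norm_smul, mul_pow, Real.norm_eq_abs, sq_abs]

theorem form_two (hs : 2 ≤ numEigenvalues G) (x : EuclideanSpace ℝ V) :
    ⟪adjOp G x, x⟫_ℝ - eigenvalue G 2 * ‖x‖ ^ 2 =
      -((eigenvalue G 2 - eigenvalue G 1) * ‖proj G 1 x‖ ^ 2) +
        ∑ i ∈ Finset.Icc 3 (numEigenvalues G),
          (eigenvalue G i - eigenvalue G 2) * ‖proj G i x‖ ^ 2 := by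
  rw [form_eq_sum_proj, sum_Icc_split hs]
  ring

theorem form_two_tail_nonneg (x : EuclideanSpace ℝ V) :
    0 ≤ ∑ i ∈ Finset.Icc 3 (numEigenvalues G),
      (eigenvalue G i - eigenvalue G 2) * ‖proj G i x‖ ^ 2 :=
  Finset.sum_nonneg fun _ hi => mul_nonneg (eigenvalue_two_lt hi).le (sq_nonneg _)

theorem exists_proj_one_eq_smul (h1 : mult G 1 = 1) (hw1 : onesProj G 1 ≠ 0)
    (x : EuclideanSpace ℝ V) : ∃ t : ℝ, proj G 1 x = t • onesProj G 1 := by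
  have hne : (⟨onesProj G 1, proj_mem G 1 _⟩ : eigenSubspace G 1) ≠ 0 := fun h =>
    hw1 (congrArg Subtype.val h)
  obtain ⟨t, ht⟩ := (finrank_eq_one_iff_of_nonzero' _ hne).1 h1 ⟨proj G 1 x, proj_mem G 1 x⟩
  exact ⟨t, (congrArg Subtype.val ht).symm⟩

/-- The estimate for the first component of a vector in the hyperplane. -/
theorem exists_smul_sq_le (hs : 2 ≤ numEigenvalues G) (h1 : mult G 1 = 1)
    (hw1 : onesProj G 1 ≠ 0) (hw2 : onesProj G 2 = 0) {x : EuclideanSpace ℝ V}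
    (hx : x ∈ sumZero V) : ∃ t : ℝ, proj G 1 x = t • onesProj G 1 ∧
      ‖proj G 1 x‖ ^ 2 = t ^ 2 * ‖onesProj G 1‖ ^ 2 ∧
      (t * ‖onesProj G 1‖ ^ 2) ^ 2 ≤ (∑ i ∈ Finset.Icc 3 (numEigenvalues G),
        (eigenvalue G i - eigenvalue G 2) * ‖proj G i x‖ ^ 2) * resolventSum G := by
  obtain ⟨t, ht⟩ := exists_proj_one_eq_smul h1 hw1 x
  refine ⟨t, ht, by rw [ht, norm_smul, mul_pow, Real.norm_eq_abs, sq_abs], ?_⟩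
  have h0 := (mem_sumZero_iff_sum_proj (G := G)).1 hx
  rw [sum_Icc_split hs, hw2, inner_zero_right, zero_add, ht, real_inner_smul_left,
    real_inner_self_eq_norm_sq] at h0
  have : t * ‖onesProj G 1‖ ^ 2 =
      -∑ i ∈ Finset.Icc 3 (numEigenvalues G), ⟪proj G i x, onesProj G i⟫_ℝ := by linarith
  rw [this, neg_sq]
  -- Cauchy–Schwarz with weights τ_i - τ_2 on one factor and their inverses on the other; the second
  -- factor is then `resolventSum`.
  refine Finset.sum_sq_le_sum_mul_sum_of_sq_le_mul _
    (fun i hi => mul_nonneg (eigenvalue_two_lt hi).le (sq_nonneg _))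
    (fun i hi => div_nonneg (sq_nonneg _) (eigenvalue_two_lt hi).le) fun i hi => ?_
  have hd := eigenvalue_two_lt hi
  have := abs_real_inner_le_norm (proj G i x) (onesProj G i)
  rw [← sq_abs]
  calc |⟪proj G i x, onesProj G i⟫_ℝ| ^ 2 ≤ (‖proj G i x‖ * ‖onesProj G i‖) ^ 2 := by gcongr
    _ = _ := by field_simp

theorem feasible_eigenvalue_two (hs : 2 ≤ numEigenvalues G) (h1 : mult G 1 = 1)
    (hw1 : onesProj G 1 ≠ 0) (hw2 : onesProj G 2 = 0)
    (hR : (eigenvalue G 2 - eigenvalue G 1) * resolventSum G ≤ ‖onesProj G 1‖ ^ 2) :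
    Feasible G (eigenvalue G 2) := by
  intro x hx
  obtain ⟨t, _, ht, hsq⟩ := exists_smul_sq_le hs h1 hw1 hw2 hx
  rw [← sub_nonneg, form_two hs, ht]
  have hX := form_two_tail_nonneg (G := G) x
  set X := ∑ i ∈ Finset.Icc 3 (numEigenvalues G),
    (eigenvalue G i - eigenvalue G 2) * ‖proj G i x‖ ^ 2
  have hd : 0 < eigenvalue G 2 - eigenvalue G 1 := sub_pos.2 (eigenvalue_lt le_rfl (by norm_num) hs)
  set d := eigenvalue G 2 - eigenvalue G 1
  have hW : 0 < ‖onesProj G 1‖ ^ 2 := by positivity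
  set W := ‖onesProj G 1‖ ^ 2
  have e1 : d * (t * W) ^ 2 ≤ X * W :=
    calc d * (t * W) ^ 2 ≤ d * (X * resolventSum G) := mul_le_mul_of_nonneg_left hsq hd.le
      _ = X * (d * resolventSum G) := by ring
      _ ≤ X * W := mul_le_mul_of_nonneg_left hR hX
  have e2 : d * (t ^ 2 * W) ≤ X := by
    refine le_of_mul_le_mul_right ?_ hW
    calc d * (t ^ 2 * W) * W = d * (t * W) ^ 2 := by ring
      _ ≤ X * W := e1
  linarith

variable (G) in
/-- Coefficients minimizing the form of `A - τ_2` among vectors of the hyperplane. -/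
noncomputable def balancedCoeff (i : ℕ) : ℝ :=
  if i = 1 then -(resolventSum G / ‖onesProj G 1‖ ^ 2) else
    if i = 2 then 0 else (eigenvalue G i - eigenvalue G 2)⁻¹

theorem balancedCoeff_of_mem_Icc_three {i : ℕ} (hi : i ∈ Finset.Icc 3 (numEigenvalues G)) :
    balancedCoeff G i = (eigenvalue G i - eigenvalue G 2)⁻¹ := by
  rw [Finset.mem_Icc] at hi
  rw [balancedCoeff, if_neg (by omega), if_neg (by omega)]

theorem balancedVector_mem_sumZero (hs : 2 ≤ numEigenvalues G) (hw1 : onesProj G 1 ≠ 0)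
    (hw2 : onesProj G 2 = 0) : onesCombo G (balancedCoeff G) ∈ sumZero V := by
  have h3 : ∑ i ∈ Finset.Icc 3 (numEigenvalues G), balancedCoeff G i * ‖onesProj G i‖ ^ 2 =
      resolventSum G := by
    refine Finset.sum_congr rfl fun i hi => ?_
    rw [balancedCoeff_of_mem_Icc_three hi, inv_mul_eq_div]
  have hW : ‖onesProj G 1‖ ^ 2 ≠ 0 := by positivity
  rw [onesCombo_mem_sumZero, sum_Icc_split hs, h3, hw2, norm_zero, balancedCoeff, if_pos rfl,
    neg_mul, div_mul_cancel₀ _ hW]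
  ring

/-- The components with i ≥ 3 contribute R = `resolventSum G`; the balancing first component
subtracts (τ_2 - τ_1)R²/‖P_1 𝟏‖². The sign is therefore that of the main angle condition whenever R
> 0. -/
theorem form_balancedVector (hs : 2 ≤ numEigenvalues G) (hw1 : onesProj G 1 ≠ 0)
    (hw2 : onesProj G 2 = 0) :
    ⟪adjOp G (onesCombo G (balancedCoeff G)), onesCombo G (balancedCoeff G)⟫_ℝ -
      eigenvalue G 2 * ‖onesCombo G (balancedCoeff G)‖ ^ 2 = resolventSum G *
        (1 - (eigenvalue G 2 - eigenvalue G 1) * resolventSum G / ‖onesProj G 1‖ ^ 2) := by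
  have h3 : ∑ i ∈ Finset.Icc 3 (numEigenvalues G), (eigenvalue G i - eigenvalue G 2) *
      (balancedCoeff G i ^ 2 * ‖onesProj G i‖ ^ 2) = resolventSum G := by
    refine Finset.sum_congr rfl fun i hi => ?_
    have := (eigenvalue_two_lt hi).ne'
    rw [balancedCoeff_of_mem_Icc_three hi]
    field_simp
  have hW : ‖onesProj G 1‖ ^ 2 ≠ 0 := by positivity
  rw [form_onesCombo, sum_Icc_split hs, h3, hw2, norm_zero, balancedCoeff, if_pos rfl]
  field_simp
  ring

/-- The second eigenvalue is infeasible unless the main angle conditions hold. -/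
theorem not_feasible_eigenvalue_two (hs : 2 ≤ numEigenvalues G)
    (hw1 : onesProj G 1 ≠ 0) (h : onesProj G 2 ≠ 0 ∨
      ‖onesProj G 1‖ ^ 2 < (eigenvalue G 2 - eigenvalue G 1) * resolventSum G) :
    ¬ Feasible G (eigenvalue G 2) := by
  intro hf
  have hd : 0 < eigenvalue G 2 - eigenvalue G 1 := sub_pos.2 (eigenvalue_lt le_rfl (by norm_num) hs)
  have hW : 0 < ‖onesProj G 1‖ ^ 2 := by positivity
  by_cases hw2 : onesProj G 2 = 0
  · have hR := h.resolve_left fun h => h hw2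
    have h1 := hf _ (balancedVector_mem_sumZero hs hw1 hw2)
    rw [← sub_nonneg, form_balancedVector hs hw1 hw2] at h1
    have hR0 : 0 < resolventSum G := pos_of_mul_pos_right (hW.trans hR) hd.le
    have : 1 - (eigenvalue G 2 - eigenvalue G 1) * resolventSum G / ‖onesProj G 1‖ ^ 2 < 0 := by
      rw [sub_neg, one_lt_div hW]
      exact hR
    nlinarith
  -- P_2 𝟏 is balanced into the hyperplane by a multiple of P_1 𝟏. The τ_2 part contributes zero to
  -- the form, leaving only the negative τ_1 part.
  · set c : ℕ → ℝ := fun i => if i = 1 then -(‖onesProj G 2‖ ^ 2 / ‖onesProj G 1‖ ^ 2) else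
      if i = 2 then 1 else 0 with hc
    have hc3 : ∀ i ∈ Finset.Icc 3 (numEigenvalues G), c i = 0 := fun i hi => by
      rw [Finset.mem_Icc] at hi
      simp only [hc]
      rw [if_neg (by omega), if_neg (by omega)]
    have hc1 : c 1 = -(‖onesProj G 2‖ ^ 2 / ‖onesProj G 1‖ ^ 2) := rfl
    have hc2 : c 2 = 1 := rfl
    have hz : onesCombo G c ∈ sumZero V := by
      rw [onesCombo_mem_sumZero, sum_Icc_split hs,
        Finset.sum_eq_zero fun i hi => by rw [hc3 i hi, zero_mul], hc1, hc2]
      field_simp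
      ring
    have h1 := hf _ hz
    rw [← sub_nonneg, form_onesCombo, sum_Icc_split hs,
      Finset.sum_eq_zero fun i hi => by rw [hc3 i hi]; ring, hc1] at h1
    have hW2 : 0 < ‖onesProj G 2‖ ^ 2 := by positivity
    have : 0 < (‖onesProj G 2‖ ^ 2 / ‖onesProj G 1‖ ^ 2) ^ 2 * ‖onesProj G 1‖ ^ 2 := by positivity
    nlinarith

/-- The second eigenspace is the part of the radical orthogonal to the first. -/
theorem mem_radical_eigenvalue_two_iff (hs : 2 ≤ numEigenvalues G) (hw2 : onesProj G 2 = 0)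
    (hf : Feasible G (eigenvalue G 2)) {x : EuclideanSpace ℝ V} :
    x ∈ radical G (eigenvalue G 2) ∧ proj G 1 x = 0 ↔ x ∈ eigenSubspace G 2 := by
  have h1 : 1 ∈ Finset.Icc 1 (numEigenvalues G) := Finset.mem_Icc.2 ⟨le_rfl, by omega⟩
  have h2 : 2 ∈ Finset.Icc 1 (numEigenvalues G) := Finset.mem_Icc.2 ⟨by norm_num, hs⟩
  constructor
  · rintro ⟨hx, hp⟩
    have h := (hf.mem_radical_iff.1 hx).2
    rw [← sub_eq_zero, form_two hs, hp, norm_zero, zero_pow two_ne_zero, mul_zero, neg_zero,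
      zero_add, Finset.sum_eq_zero_iff_of_nonneg fun i hi =>
        mul_nonneg (eigenvalue_two_lt hi).le (sq_nonneg _)] at h
    refine mem_eigenSubspace_of_proj fun j hj hj2 => ?_
    by_cases hj1 : j = 1
    · rw [hj1, hp]
    · rw [Finset.mem_Icc] at hj
      have hj3 : j ∈ Finset.Icc 3 (numEigenvalues G) := Finset.mem_Icc.2 ⟨by omega, hj.2⟩
      simpa [(eigenvalue_two_lt hj3).ne'] using h j hj3
  · intro hx
    exact ⟨hf.mem_radical_iff.2 ⟨eigenSubspace_le_sumZero_iff.2 hw2 hx,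
      form_of_mem_eigenSubspace hx⟩, proj_of_mem_ne h2 h1 (by norm_num) hx⟩

/-- Rank-nullity for the projection of the radical to the first eigenspace, whose kernel is the
second eigenspace. Any excess over m_2 is visible in that projection. -/
theorem finrank_radical_eigenvalue_two (hs : 2 ≤ numEigenvalues G) (hw2 : onesProj G 2 = 0)
    (hf : Feasible G (eigenvalue G 2)) :
    Module.finrank ℝ (radical G (eigenvalue G 2)) = mult G 2 +
      Module.finrank ℝ ((radical G (eigenvalue G 2)).map (proj G 1)) := by
  set f := (proj G 1).comp (radical G (eigenvalue G 2)).subtype with hfdef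
  have hker : (LinearMap.ker f).map (radical G (eigenvalue G 2)).subtype = eigenSubspace G 2 := by
    ext x
    rw [← mem_radical_eigenvalue_two_iff hs hw2 hf]
    constructor
    · rintro ⟨y, hy, rfl⟩
      exact ⟨y.2, hy⟩
    · rintro ⟨hx, hp⟩
      exact ⟨⟨x, hx⟩, hp, rfl⟩
  have hrange : LinearMap.range f = (radical G (eigenvalue G 2)).map (proj G 1) := by
    rw [hfdef, LinearMap.range_comp, Submodule.range_subtype]
  rw [← f.finrank_range_add_finrank_ker, hrange, mult, ← hker, Submodule.finrank_map_subtype_eq,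
    add_comm]

/-- The strict main angle condition. -/
theorem finrank_radical_of_lt (hs : 2 ≤ numEigenvalues G) (h1 : mult G 1 = 1)
    (hw1 : onesProj G 1 ≠ 0) (hw2 : onesProj G 2 = 0)
    (hR : (eigenvalue G 2 - eigenvalue G 1) * resolventSum G < ‖onesProj G 1‖ ^ 2) :
    Module.finrank ℝ (radical G (eigenvalue G 2)) = mult G 2 := by
  have hf := feasible_eigenvalue_two hs h1 hw1 hw2 hR.le
  rw [finrank_radical_eigenvalue_two hs hw2 hf]
  have : (radical G (eigenvalue G 2)).map (proj G 1) = ⊥ := by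
    rw [Submodule.eq_bot_iff]
    rintro _ ⟨x, hx, rfl⟩
    obtain ⟨t, hpt, ht, hsq⟩ := exists_smul_sq_le hs h1 hw1 hw2 hx.1
    have h := (hf.mem_radical_iff.1 hx).2
    rw [← sub_eq_zero, form_two hs, ht] at h
    have hd : 0 < eigenvalue G 2 - eigenvalue G 1 :=
      sub_pos.2 (eigenvalue_lt le_rfl (by norm_num) hs)
    have hW : 0 < ‖onesProj G 1‖ ^ 2 := by positivity
    -- Nullity turns the tail of the form into (τ_2 - τ_1)t²‖P_1 𝟏‖². Substituted in the
    -- Cauchy–Schwarz bound, strictness leaves only t = 0.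
    rw [neg_add_eq_zero.1 h |>.symm] at hsq
    have h2 : t ^ 2 * (‖onesProj G 1‖ ^ 2 * (‖onesProj G 1‖ ^ 2 -
        (eigenvalue G 2 - eigenvalue G 1) * resolventSum G)) ≤ 0 := by linarith
    have h3 : t ^ 2 = 0 := le_antisymm
      (nonpos_of_mul_nonpos_left h2 (mul_pos hW (sub_pos.2 hR))) (sq_nonneg t)
    rw [hpt, pow_eq_zero_iff two_ne_zero |>.1 h3, zero_smul]
  rw [this, finrank_bot, add_zero]

/-- The main angle equality. -/
theorem finrank_radical_of_eq (hs : 2 ≤ numEigenvalues G) (h1 : mult G 1 = 1)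
    (hw1 : onesProj G 1 ≠ 0) (hw2 : onesProj G 2 = 0)
    (hR : (eigenvalue G 2 - eigenvalue G 1) * resolventSum G = ‖onesProj G 1‖ ^ 2) :
    Module.finrank ℝ (radical G (eigenvalue G 2)) = mult G 2 + 1 := by
  have hf := feasible_eigenvalue_two hs h1 hw1 hw2 hR.le
  rw [finrank_radical_eigenvalue_two hs hw2 hf]
  have hW : 0 < ‖onesProj G 1‖ ^ 2 := by positivity
  have hle : (radical G (eigenvalue G 2)).map (proj G 1) ≤ eigenSubspace G 1 := by
    rintro _ ⟨x, _, rfl⟩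
    exact proj_mem G 1 x
  have hle1 := Submodule.finrank_mono hle
  change _ ≤ mult G 1 at hle1
  -- At equality the balanced vector is null, and its first component is nonzero: this is the extra
  -- dimension.
  have hz : onesCombo G (balancedCoeff G) ∈ radical G (eigenvalue G 2) := by
    refine hf.mem_radical_iff.2 ⟨balancedVector_mem_sumZero hs hw1 hw2, ?_⟩
    rw [← sub_eq_zero, form_balancedVector hs hw1 hw2, hR, div_self hW.ne', sub_self, mul_zero]
  have hne : (radical G (eigenvalue G 2)).map (proj G 1) ≠ ⊥ := by
    intro h
    have h2 := (Submodule.eq_bot_iff _).1 h _ ⟨_, hz, rfl⟩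
    rw [proj_onesCombo _ (Finset.mem_Icc.2 ⟨le_rfl, by omega⟩)] at h2
    have h3 := (smul_eq_zero.1 h2).resolve_right hw1
    have h4 : resolventSum G ≠ 0 := by
      intro h
      rw [h, mul_zero] at hR
      exact hW.ne hR
    have : balancedCoeff G 1 = -(resolventSum G / ‖onesProj G 1‖ ^ 2) := rfl
    rw [this, neg_eq_zero, div_eq_zero_iff] at h3
    exact h3.elim h4 hW.ne'
  have hpos : Module.finrank ℝ ((radical G (eigenvalue G 2)).map (proj G 1)) ≠ 0 := fun h =>
    hne (Submodule.finrank_eq_zero.1 h)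
  omega

/-- When the second eigenvalue is infeasible, the largest nullity is one. -/
theorem isMaxNullity_one [Nontrivial V] (hs : 2 ≤ numEigenvalues G) (h1 : mult G 1 = 1)
    (hG : ¬ ∀ c : G.ConnectedComponent, G.IsClique c.supp)
    (hnf : ¬ Feasible G (eigenvalue G 2)) : IsMaxNullity G 1 := by
  obtain ⟨μ, hf, h0⟩ := exists_feasible_radical_ne_bot G
  have hμ : μ < eigenvalue G 2 := by
    by_contra! h
    refine hnf fun x hx => (mul_le_mul_of_nonneg_right h (sq_nonneg _)).trans (hf x hx)
  let f : radical G μ →ₗ[ℝ] eigenSubspace G 1 :=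
    ((proj G 1).comp (radical G μ).subtype).codRestrict _ fun x => proj_mem G 1 x
  -- A vector with no first component has Rayleigh quotient at least τ_2 > μ, so it cannot be a
  -- nonzero radical vector.
  have hinj : Function.Injective f := by
    rw [← LinearMap.ker_eq_bot, Submodule.eq_bot_iff]
    intro x hx
    have hp : proj G 1 x = 0 := congrArg Subtype.val hx
    have h2 := (hf.mem_radical_iff.1 x.2).2
    have h3 := form_two hs (x : EuclideanSpace ℝ V)
    have h4 := form_two_tail_nonneg (G := G) (x : EuclideanSpace ℝ V)
    rw [hp, norm_zero] at h3
    by_contra hne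
    have hne' : (x : EuclideanSpace ℝ V) ≠ 0 := fun h => hne (Subtype.ext h)
    have : 0 < ‖(x : EuclideanSpace ℝ V)‖ ^ 2 := by positivity
    nlinarith
  have hle1 : Module.finrank ℝ (radical G μ) ≤ mult G 1 :=
    LinearMap.finrank_le_finrank_of_injective hinj
  have hpos : Module.finrank ℝ (radical G μ) ≠ 0 := fun h => h0 (Submodule.finrank_eq_zero.1 h)
  have h := hf.isMaxNullity (hf.lt_neg_one hG) h0
  rwa [show Module.finrank ℝ (radical G μ) = 1 by omega] at h

/-- If β_1 = β_2 = 0, the all-ones vector lives in the eigenspaces with i ≥ 3, so the right-hand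
side is positive while the left is zero. Hence `mTwo'` cannot interfere when β_1 = 0. -/
theorem mTwo'_eq_zero_of_onesProj_one [Nonempty V] (hw1 : onesProj G 1 = 0) : mTwo' G = 0 := by
  have key : onesProj G 2 = 0 → lhsTwo G < rhsTwo G := by
    intro hw2
    have hn : (0 : ℝ) < Fintype.card V := by exact_mod_cast Fintype.card_pos
    rw [lhsTwo_eq, rhsTwo_eq, hw1, norm_zero, zero_pow two_ne_zero, zero_div, zero_div]
    refine div_pos (lt_of_le_of_ne (Finset.sum_nonneg fun i hi =>
      div_nonneg (sq_nonneg _) (eigenvalue_two_lt hi).le) fun h => ?_) hn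
    rw [eq_comm, resolventSum, Finset.sum_eq_zero_iff_of_nonneg fun i hi =>
      div_nonneg (sq_nonneg _) (eigenvalue_two_lt hi).le] at h
    have hsum := sum_proj (G := G) (WithLp.toLp 2 (fun _ : V => (1 : ℝ)))
    rw [Finset.sum_eq_zero] at hsum
    · obtain ⟨v⟩ := ‹Nonempty V›
      have := congrFun (congrArg WithLp.ofLp hsum) v
      simp at this
    · intro i hi
      rw [Finset.mem_Icc] at hi
      rcases (by omega : i = 1 ∨ i = 2 ∨ 3 ≤ i) with rfl | rfl | h3
      · exact hw1
      · exact hw2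
      · have hi3 : i ∈ Finset.Icc 3 (numEigenvalues G) := Finset.mem_Icc.2 ⟨h3, hi.2⟩
        change onesProj G i = 0
        simpa [(eigenvalue_two_lt hi3).ne'] using h i hi3
  rw [mTwo', if_neg, if_neg]
  · rintro ⟨_, _, h, hlt⟩
    exact lt_asymm hlt (key (mainAngle_eq_zero.1 h))
  · rintro ⟨_, _, h, he⟩
    exact (key (mainAngle_eq_zero.1 h)).ne he

/-- Guarantees that τ_2 is a genuine eigenvalue and not the default value 0. -/
theorem two_le_numEigenvalues [Nontrivial V] (h1 : mult G 1 = 1) : 2 ≤ numEigenvalues G := by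
  by_contra! h
  have hs : numEigenvalues G = 1 := le_antisymm (by omega) one_le_numEigenvalues
  have htop : eigenSubspace G 1 = ⊤ := by
    rw [eq_top_iff]
    intro x _
    refine mem_eigenSubspace_of_proj fun j hj hj1 => ?_
    rw [hs, Finset.mem_Icc] at hj
    omega
  rw [mult, htop, finrank_top, finrank_euclideanSpace] at h1
  have := Fintype.one_lt_card (α := V)
  omega

/-- The largest nullity of a graph that is not a disjoint union of cliques. -/
theorem isMaxNullity_of_not_isClique
    (hG : ¬ ∀ c : G.ConnectedComponent, G.IsClique c.supp) :
    IsMaxNullity G (max (mOne' G) (max (mTwo' G) 2) - 1) := by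
  obtain ⟨u, v, _, huv, -⟩ := exists_induced_path hG
  have : Nontrivial V := ⟨u, v, huv.ne⟩
  have hm1 : 0 < mult G 1 :=
    Nat.pos_of_ne_zero fun h => eigenSubspace_ne_bot one_mem_Icc (Submodule.finrank_eq_zero.1 h)
  have hτ1 := (feasible_eigenvalue_one (G := G)).lt_neg_one hG
  have hmax1 : ∀ k, 0 < k → Module.finrank ℝ (radical G (eigenvalue G 1)) = k →
      IsMaxNullity G k := by
    rintro k hk rfl
    refine feasible_eigenvalue_one.isMaxNullity hτ1 fun h => ?_
    rw [h, finrank_bot] at hk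
    exact lt_irrefl 0 hk
  by_cases hw1 : onesProj G 1 = 0
  · rw [mTwo'_eq_zero_of_onesProj_one hw1, mOne', if_pos (mainAngle_eq_zero.2 hw1)]
    have h := hmax1 (mult G 1) hm1 (by
      rw [radical_eigenvalue_one, inf_eq_left.2 (eigenSubspace_le_sumZero_iff.2 hw1), mult])
    rwa [show max (mult G 1 + 1) (max 0 2) - 1 = mult G 1 by omega]
  have hβ1 : mainAngle G 1 ≠ 0 := fun h => hw1 (mainAngle_eq_zero.1 h)
  rw [mOne', if_neg hβ1]
  by_cases h1 : mult G 1 = 1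
  swap
  -- Here m_1 ≥ 2 and β_1 ≠ 0: the hyperplane cuts the first eigenspace down by one dimension, and
  -- m_1 - 1 > 0 remain.
  · have h := finrank_inf_sumZero fun h => hw1 (eigenSubspace_le_sumZero_iff.1 h)
    rw [← radical_eigenvalue_one] at h
    change _ = mult G 1 at h
    rw [mTwo', if_neg fun h => h1 h.2.1, if_neg fun h => h1 h.2.1,
      show max (mult G 1) (max 0 2) - 1 = mult G 1 - 1 by omega]
    exact hmax1 _ (by omega) (by omega)
  have hs := two_le_numEigenvalues h1
  have hd : 0 < eigenvalue G 2 - eigenvalue G 1 :=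
    sub_pos.2 (eigenvalue_lt le_rfl (by norm_num) hs)
  have hn : (0 : ℝ) < Fintype.card V := by exact_mod_cast Fintype.card_pos
  have hm2 : 0 < mult G 2 := Nat.pos_of_ne_zero fun h =>
    eigenSubspace_ne_bot (Finset.mem_Icc.2 ⟨by norm_num, hs⟩) (Submodule.finrank_eq_zero.1 h)
  have hlt : rhsTwo G < lhsTwo G ↔
      (eigenvalue G 2 - eigenvalue G 1) * resolventSum G < ‖onesProj G 1‖ ^ 2 := by
    rw [lhsTwo_eq, rhsTwo_eq, div_lt_div_iff_of_pos_right hn, lt_div_iff₀' hd]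
  have heq : lhsTwo G = rhsTwo G ↔
      (eigenvalue G 2 - eigenvalue G 1) * resolventSum G = ‖onesProj G 1‖ ^ 2 := by
    rw [lhsTwo_eq, rhsTwo_eq, div_left_inj' hn.ne', div_eq_iff hd.ne', mul_comm, eq_comm]
  have hmax2 : ∀ k, 0 < k → Feasible G (eigenvalue G 2) →
      Module.finrank ℝ (radical G (eigenvalue G 2)) = k → IsMaxNullity G k := by
    rintro k hk hf rfl
    refine hf.isMaxNullity (hf.lt_neg_one hG) fun h => ?_
    rw [h, finrank_bot] at hk
    exact lt_irrefl 0 hk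
  by_cases hw2 : onesProj G 2 = 0
  · have hβ2 : mainAngle G 2 = 0 := mainAngle_eq_zero.2 hw2
    rcases lt_trichotomy ((eigenvalue G 2 - eigenvalue G 1) * resolventSum G)
      (‖onesProj G 1‖ ^ 2) with h | h | h
    · have hf := feasible_eigenvalue_two hs h1 hw1 hw2 h.le
      rw [mTwo', if_neg fun h' => h.ne (heq.1 h'.2.2.2),
        -- The requirement τ_2 < -1 follows from feasibility, through the induced path.
        if_pos ⟨hf.lt_neg_one hG, h1, hβ2, hlt.2 h⟩, h1,
        show max 1 (max (mult G 2 + 1) 2) - 1 = mult G 2 by omega]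
      exact hmax2 _ hm2 hf (finrank_radical_of_lt hs h1 hw1 hw2 h)
    · have hf := feasible_eigenvalue_two hs h1 hw1 hw2 h.le
      rw [mTwo', if_pos ⟨hf.lt_neg_one hG, h1, hβ2, heq.2 h⟩, h1,
        show max 1 (max (mult G 2 + 2) 2) - 1 = mult G 2 + 1 by omega]
      exact hmax2 _ (Nat.succ_pos _) hf (finrank_radical_of_eq hs h1 hw1 hw2 h)
    · rw [mTwo', if_neg fun h' => h.ne' (heq.1 h'.2.2.2),
        if_neg fun h' => lt_asymm h (hlt.1 h'.2.2.2), h1]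
      exact isMaxNullity_one hs h1 hG (not_feasible_eigenvalue_two hs hw1 (Or.inr h))
  · have hβ2 : mainAngle G 2 ≠ 0 := fun h => hw2 (mainAngle_eq_zero.1 h)
    rw [mTwo', if_neg fun h' => hβ2 h'.2.2.1, if_neg fun h' => hβ2 h'.2.2.1, h1]
    exact isMaxNullity_one hs h1 hG (not_feasible_eigenvalue_two hs hw1 (Or.inl hw2))

end Spectral

/-! ### The three cases of the theorem -/

theorem isClique_supp_of_eq_top_or_eq_bot {V : Type*} {G : SimpleGraph V} (h : G = ⊤ ∨ G = ⊥)
    (c : G.ConnectedComponent) : G.IsClique c.supp := by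
  intro u hu v hv huv
  rcases h with rfl | rfl
  · exact huv
  · exact (huv (SimpleGraph.reachable_bot.1
      (SimpleGraph.ConnectedComponent.exact (hu.trans hv.symm)))).elim

theorem not_isClique_supp_of_not_isDisjointUnionOfCliques {V : Type*} [Finite V] [Nonempty V]
    {G : SimpleGraph V} (hG : G ≠ ⊤) (h : ¬ IsDisjointUnionOfCliques G) :
    ¬ ∀ c : G.ConnectedComponent, G.IsClique c.supp := by
  intro hc
  refine h ⟨hc, ?_⟩
  by_contra! hlt
  have hsub : Subsingleton G.ConnectedComponent :=
    Finite.card_le_one_iff_subsingleton.1 (by omega)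
  refine hG (eq_top_iff.2 fun u v huv => ?_)
  exact hc (G.connectedComponentMk u) rfl (Subsingleton.elim _ _) huv

theorem repNumber_compl {V : Type*} (G : SimpleGraph V) : repNumber Gᶜ = repNumber G := by
  simp only [repNumber, representable_compl_iff]

end EuclideanRep

theorem mainTheorem1 {V : Type*} [Fintype V] [DecidableEq V] [Nonempty V]
    (G : SimpleGraph V) [DecidableRel G.Adj] :
    -- the representation number is a genuine minimum
    (∃ m : ℕ, EuclideanRep.Representable G m) ∧
    ((G = ⊤ ∨ Gᶜ = ⊤) →
      (EuclideanRep.repNumber G : ℤ) = (Fintype.card V : ℤ) - 1) ∧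
    (¬ (G = ⊤ ∨ Gᶜ = ⊤) →
      (EuclideanRep.IsDisjointUnionOfCliques G →
        (EuclideanRep.repNumber G : ℤ) =
          (Fintype.card V : ℤ) - (max (EuclideanRep.numLargestComponents G) 2 : ℕ)) ∧
      (EuclideanRep.IsDisjointUnionOfCliques Gᶜ →
        (EuclideanRep.repNumber G : ℤ) =
          (Fintype.card V : ℤ) - (max (EuclideanRep.numLargestComponents Gᶜ) 2 : ℕ)) ∧
      (¬ (EuclideanRep.IsDisjointUnionOfCliques G ∨ EuclideanRep.IsDisjointUnionOfCliques Gᶜ) →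
        (EuclideanRep.repNumber G : ℤ) =
          (Fintype.card V : ℤ) -
            (max (EuclideanRep.mOne' G) (max (EuclideanRep.mTwo' G)
              (max (EuclideanRep.mOne' Gᶜ) (max (EuclideanRep.mTwo' Gᶜ) 2))) : ℕ))) := by
  have h1 : (G = ⊤ ∨ Gᶜ = ⊤) → EuclideanRep.IsMaxNullity G 0 ∧ EuclideanRep.IsMaxNullity Gᶜ 0 := by
    intro h
    have hG : G = ⊤ ∨ G = ⊥ := h.imp_right compl_eq_top.1
    have hGc : Gᶜ = ⊤ ∨ Gᶜ = ⊥ := h.symm.imp_right compl_eq_bot.2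
    exact ⟨EuclideanRep.isMaxNullity_zero_of_isClique
        (EuclideanRep.isClique_supp_of_eq_top_or_eq_bot hG),
      EuclideanRep.isMaxNullity_zero_of_isClique
        (EuclideanRep.isClique_supp_of_eq_top_or_eq_bot hGc)⟩
  have h2 : ∀ (H : SimpleGraph V) [DecidableRel H.Adj], Hᶜ ≠ ⊤ →
      EuclideanRep.IsDisjointUnionOfCliques H → EuclideanRep.IsMaxNullity H 0 ∧
        EuclideanRep.IsMaxNullity Hᶜ (max (EuclideanRep.numLargestComponents H) 2 - 1) :=
    fun H _ hH h => ⟨EuclideanRep.isMaxNullity_zero_of_isClique h.1,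
      EuclideanRep.isMaxNullity_compl_of_isDisjointUnionOfCliques h hH⟩
  have h3 : ¬ (G = ⊤ ∨ Gᶜ = ⊤) → ¬ (EuclideanRep.IsDisjointUnionOfCliques G ∨
      EuclideanRep.IsDisjointUnionOfCliques Gᶜ) →
      EuclideanRep.IsMaxNullity G (max (EuclideanRep.mOne' G) (max (EuclideanRep.mTwo' G) 2) - 1) ∧
      EuclideanRep.IsMaxNullity Gᶜ
        (max (EuclideanRep.mOne' Gᶜ) (max (EuclideanRep.mTwo' Gᶜ) 2) - 1) := by
    intro hne h
    rw [not_or] at hne h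
    exact ⟨EuclideanRep.isMaxNullity_of_not_isClique
        (EuclideanRep.not_isClique_supp_of_not_isDisjointUnionOfCliques hne.1 h.1),
      EuclideanRep.isMaxNullity_of_not_isClique
        (EuclideanRep.not_isClique_supp_of_not_isDisjointUnionOfCliques hne.2 h.2)⟩
  refine ⟨?_, fun h => ?_, fun hne => ⟨fun h => ?_, fun h => ?_, fun h => ?_⟩⟩
  · by_cases hne : G = ⊤ ∨ Gᶜ = ⊤
    · exact (EuclideanRep.repNumber_add_of_isMaxNullity (h1 hne).1 (h1 hne).2).1
    by_cases h : EuclideanRep.IsDisjointUnionOfCliques G ∨ EuclideanRep.IsDisjointUnionOfCliques Gᶜ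
    · rcases h with h | h
      · have := h2 G (fun h => hne (Or.inr h)) h
        exact (EuclideanRep.repNumber_add_of_isMaxNullity this.1 this.2).1
      · have := h2 Gᶜ (fun h => hne (Or.inl (by simpa using h))) h
        obtain ⟨m, hm⟩ := (EuclideanRep.repNumber_add_of_isMaxNullity this.1 this.2).1
        exact ⟨m, EuclideanRep.representable_compl_iff.1 hm⟩
    · exact (EuclideanRep.repNumber_add_of_isMaxNullity (h3 hne h).1 (h3 hne h).2).1
  · have := (EuclideanRep.repNumber_add_of_isMaxNullity (h1 h).1 (h1 h).2).2
    omega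
  · have := h2 G (fun h => hne (Or.inr h)) h
    have := (EuclideanRep.repNumber_add_of_isMaxNullity this.1 this.2).2
    omega
  · have := h2 Gᶜ (fun h => hne (Or.inl (by simpa using h))) h
    have := (EuclideanRep.repNumber_add_of_isMaxNullity this.1 this.2).2
    rw [EuclideanRep.repNumber_compl] at this
    omega
  · have := (EuclideanRep.repNumber_add_of_isMaxNullity (h3 hne h).1 (h3 hne h).2).2
    omega
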